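/- Conventions. Fix $1\le k\le\infty$. Manifolds are of class $C^k$ and without boundary; vector bundles are real, of locally finite rank and of some class $C^l$ with $1\le l\le k$. A connection on a vector bundle $E$ of class $C^l$ over a manifold $M$ is a morphism of abelian sheaves $\nabla\colon C^1(E)\to C^0(T^\vee(M)\otimes E)$ on $M$ such that $\nabla_U(fs)=df\otimes s+f\,\nabla_U(s)$ for all open $U\subset M$, $f\in C^1(U)$, $s\in C^1(U,E)$. It is of class $C^m$ ($0\le m\le\infty$) if $m+1\le l$ and $\nabla$ maps $C^l(E)$ into $C^m(T^\vee(M)\otimes E)$. A section $s\in C^1(U,E)$ is $\nabla$-parallel if $\nabla_U(s)=0$. A closed subset $F\subset M$ is negligible in $M$ for all connections of class $C^m$ if, for every vector bundle $E$ over $M$ and every connection $\nabla$ of class $C^m$ on $E$, every $\nabla$-parallel section of $E$ over $M\setminus F$ is the restriction of a $\nabla$-parallel section of $E$ over $M$. Lemma. Let $n\ge 2$, let $I_1,\dots,I_n\subset\mathbb{R}$ be open intervals, let $M=I_1\times\dots\times I_n$ with its canonical manifold structure, and let $F$ be a closed subset of $M$. (i) If $C_2\subset I_2$ is discrete (every point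 of $C_2$ is an isolated point of $C_2$), $b_1\in I_1$, and $F\subset\{x\in M\mid b_1\le x_1,\ x_2\in C_2\}$, then $F$ is negligible in $M$ for all connections of class $C^0$. (ii) If $C_2\subset I_2$ is nowhere dense in $I_2$, $b_1\in I_1$, and $F\subset\{x\in M\mid b_1\le x_1,\ x_2\in C_2\}$, then $F$ is negligible in $M$ for all connections of class $C^1$. (iii) If $C_1\subset I_1$ is nowhere dense in $I_1$, $C_2\subset I_2$ is nowhere dense in $I_2$, $b_1\in I_1$, $b_2\in I_2$, and $$F\subset\{x\in M\mid b_1\le x_1,\ x_2\in C_2\}\cap\{x\in M\mid b_2\le x_2,\ x_1\in C_1\},$$ then $F$ is negligible in $M$ for all connections of class $C^0$. -/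

import Mathlib

open Bundle TopologicalSpace
open scoped Manifold ContDiff

universe uM uF uV

/-- `s` is a section of class `C^m` over the set `U` (in practice open) in the vector bundle `V`
with model fibre `F`, over the manifold `M`, which is modelled on `ℝⁿ`. Sections over `U` are
represented by functions on all of `M`, of which only the values at the points of `U` matter. -/
def IsSectionOn (n : ℕ) {M : Type uM} [TopologicalSpace M]
    [ChartedSpace (EuclideanSpace ℝ (Fin n)) M]
    (F : Type uF) [NormedAddCommGroup F] [NormedSpace ℝ F]
    {V : M → Type uV} [TopologicalSpace (TotalSpace F V)]
    [∀ x, TopologicalSpace (V x)] [FiberBundle F V]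
    (m : ℕ∞) (U : Set M) (s : Π x : M, V x) : Prop :=
  ContMDiffOn (𝓡 n) ((𝓡 n).prod 𝓘(ℝ, F)) m (fun x ↦ TotalSpace.mk' F x (s x)) U

/-- `ξ` is a section of class `C^m` over the set `U` in the vector bundle
`T^∨M ⊗ V = Hom(TM, V)`. -/
def IsOneFormOn (n : ℕ) {M : Type uM} [TopologicalSpace M]
    [ChartedSpace (EuclideanSpace ℝ (Fin n)) M] [IsManifold (𝓡 n) 1 M]
    (F : Type uF) [NormedAddCommGroup F] [NormedSpace ℝ F]
    {V : M → Type uV} [TopologicalSpace (TotalSpace F V)]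
    [∀ x, AddCommGroup (V x)] [∀ x, Module ℝ (V x)] [∀ x, TopologicalSpace (V x)]
    [∀ x, IsTopologicalAddGroup (V x)] [∀ x, ContinuousSMul ℝ (V x)]
    [FiberBundle F V] [VectorBundle ℝ F V]
    (m : ℕ∞) (U : Set M) (ξ : Π x : M, TangentSpace (𝓡 n) x →L[ℝ] V x) : Prop :=
  IsSectionOn n (EuclideanSpace ℝ (Fin n) →L[ℝ] F)
    (V := fun x : M ↦ TangentSpace (𝓡 n) x →L[ℝ] V x) m U ξ

/-- A (continuous, linear) connection on the vector bundle `V` over the `n`-dimensional manifold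
`M`: a morphism of abelian sheaves `∇ : C¹(V) → C⁰(T^∨M ⊗ V)` on `M` satisfying the Leibniz rule.
`toFun U` is the component of `∇` over the open set `U`; only its values at sections that are of
class `C¹` over `U`, and of these only the values at points of `U`, are meaningful. -/
structure Connection (n : ℕ) {M : Type uM} [TopologicalSpace M]
    [ChartedSpace (EuclideanSpace ℝ (Fin n)) M] [IsManifold (𝓡 n) 1 M]
    (F : Type uF) [NormedAddCommGroup F] [NormedSpace ℝ F]
    (V : M → Type uV) [TopologicalSpace (TotalSpace F V)]
    [∀ x, AddCommGroup (V x)] [∀ x, Module ℝ (V x)] [∀ x, TopologicalSpace (V x)]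
    [∀ x, IsTopologicalAddGroup (V x)] [∀ x, ContinuousSMul ℝ (V x)]
    [FiberBundle F V] [VectorBundle ℝ F V] where
  toFun : Opens M → (Π x : M, V x) → Π x : M, TangentSpace (𝓡 n) x →L[ℝ] V x
  /-- `∇_U` maps `C¹(U, V)` into `C⁰(U, T^∨M ⊗ V)`. -/
  continuous' : ∀ (U : Opens M) (s : Π x : M, V x),
    IsSectionOn n F 1 (U : Set M) s → IsOneFormOn n F 0 (U : Set M) (toFun U s)
  /-- Compatibility with the restriction of sections from `U` to `W ⊆ U`. (For `W = U` this says
  that `∇_U s` on `U` depends on the values of `s` on `U` only.) -/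
  restrict' : ∀ (W U : Opens M) (s t : Π x : M, V x), W ≤ U →
    IsSectionOn n F 1 (U : Set M) s → (∀ x ∈ W, t x = s x) →
    ∀ x ∈ W, toFun W t x = toFun U s x
  add' : ∀ (U : Opens M) (s t : Π x : M, V x),
    IsSectionOn n F 1 (U : Set M) s → IsSectionOn n F 1 (U : Set M) t →
    ∀ x ∈ U, toFun U (s + t) x = toFun U s x + toFun U t x
  /-- `∇(f s) = df ⊗ s + f ∇s`. -/
  leibniz' : ∀ (U : Opens M) (f : M → ℝ) (s : Π x : M, V x),
    ContMDiffOn (𝓡 n) 𝓘(ℝ, ℝ) 1 f (U : Set M) → IsSectionOn n F 1 (U : Set M) s →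
    ∀ x ∈ U, toFun U (fun y ↦ f y • s y) x =
      (mvfderiv (𝓡 n) f x).smulRight (s x) + f x • toFun U s x

/-- `s` is a `∇`-parallel section over the open set `U`, i.e. it lies in the kernel of `∇_U`. -/
def Connection.IsParallelOn {n : ℕ} {M : Type uM} [TopologicalSpace M]
    [ChartedSpace (EuclideanSpace ℝ (Fin n)) M] [IsManifold (𝓡 n) 1 M]
    {F : Type uF} [NormedAddCommGroup F] [NormedSpace ℝ F]
    {V : M → Type uV} [TopologicalSpace (TotalSpace F V)]
    [∀ x, AddCommGroup (V x)] [∀ x, Module ℝ (V x)] [∀ x, TopologicalSpace (V x)]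
    [∀ x, IsTopologicalAddGroup (V x)] [∀ x, ContinuousSMul ℝ (V x)]
    [FiberBundle F V] [VectorBundle ℝ F V]
    (D : Connection n F V) (U : Opens M) (s : Π x : M, V x) : Prop :=
  IsSectionOn n F 1 (U : Set M) s ∧ ∀ x ∈ U, D.toFun U s x = 0

/-- The connection `∇`, on a vector bundle `V` of class `C^l`, is of class `C^m`: one has
`m + 1 ≤ l`, and `∇` maps `C^l(V)` into `C^m(T^∨M ⊗ V)`. -/
def Connection.IsOfClass {n : ℕ} {M : Type uM} [TopologicalSpace M]
    [ChartedSpace (EuclideanSpace ℝ (Fin n)) M] [IsManifold (𝓡 n) 1 M]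
    {F : Type uF} [NormedAddCommGroup F] [NormedSpace ℝ F]
    {V : M → Type uV} [TopologicalSpace (TotalSpace F V)]
    [∀ x, AddCommGroup (V x)] [∀ x, Module ℝ (V x)] [∀ x, TopologicalSpace (V x)]
    [∀ x, IsTopologicalAddGroup (V x)] [∀ x, ContinuousSMul ℝ (V x)]
    [FiberBundle F V] [VectorBundle ℝ F V]
    (D : Connection n F V) (l m : ℕ∞) : Prop :=
  m + 1 ≤ l ∧ ∀ (U : Opens M) (s : Π x : M, V x),
    IsSectionOn n F l (U : Set M) s → IsOneFormOn n F m (U : Set M) (D.toFun U s)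

/-- The closed set `A` is negligible in `M` for `(V, ∇)`: every `∇`-parallel section over `M \ A`
is the restriction of a `∇`-parallel section over `M`. -/
def Connection.IsNegligible {n : ℕ} {M : Type uM} [TopologicalSpace M]
    [ChartedSpace (EuclideanSpace ℝ (Fin n)) M] [IsManifold (𝓡 n) 1 M]
    {F : Type uF} [NormedAddCommGroup F] [NormedSpace ℝ F]
    {V : M → Type uV} [TopologicalSpace (TotalSpace F V)]
    [∀ x, AddCommGroup (V x)] [∀ x, Module ℝ (V x)] [∀ x, TopologicalSpace (V x)]
    [∀ x, IsTopologicalAddGroup (V x)] [∀ x, ContinuousSMul ℝ (V x)]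
    [FiberBundle F V] [VectorBundle ℝ F V]
    (D : Connection n F V) (A : Closeds M) : Prop :=
  ∀ s : Π x : M, V x, D.IsParallelOn A.compl s →
    ∃ t : Π x : M, V x, D.IsParallelOn ⊤ t ∧ ∀ x ∉ A, t x = s x

/-- For a connected manifold `M` of class `C^k`: the closed set `A` is negligible in `M` for all
connections of class `C^m`, that is, for all real vector bundles `V` over `M` of finite rank and of
any class `C^l`, `1 ≤ l ≤ k`, and all connections of class `C^m` on `V`. (As `M` is connected, the
rank of a vector bundle of locally finite rank is constant, so that there is one model fibre
`F`.) -/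
def NegligibleForAllConnections (n : ℕ) {M : Type uM} [TopologicalSpace M]
    [ChartedSpace (EuclideanSpace ℝ (Fin n)) M] [IsManifold (𝓡 n) 1 M]
    (k : ℕ∞) [IsManifold (𝓡 n) k M] (m : ℕ∞) (A : Closeds M) : Prop :=
  ∀ (l : ℕ∞), 1 ≤ l → l ≤ k →
  ∀ (F : Type uF) [NormedAddCommGroup F] [NormedSpace ℝ F] [FiniteDimensional ℝ F]
    (V : M → Type uV) [TopologicalSpace (TotalSpace F V)]
    [∀ x, AddCommGroup (V x)] [∀ x, Module ℝ (V x)] [∀ x, TopologicalSpace (V x)]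
    [∀ x, IsTopologicalAddGroup (V x)] [∀ x, ContinuousSMul ℝ (V x)]
    [FiberBundle F V] [VectorBundle ℝ F V] [ContMDiffVectorBundle l F V (𝓡 n)]
    (D : Connection n F V), D.IsOfClass l m → D.IsNegligible A

/-- The product `J₁ × … × Jₙ`, as an open subset of `ℝⁿ` (it carries the manifold structure of an
open subset of `ℝⁿ`). -/
def openBox {n : ℕ} (J : Fin n → Opens ℝ) : Opens (EuclideanSpace ℝ (Fin n)) where
  carrier := {x | ∀ i, x i ∈ J i}
  is_open' := by
    simp only [Set.ofPred_forall]
    exact isOpen_iInter_of_finite fun i ↦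
      (J i).isOpen.preimage (EuclideanSpace.proj (𝕜 := ℝ) i).continuous

/-! In a local trivialization the connection is `d + Γ` with `Γ` continuous, so a section is
parallel iff its representative `t` satisfies `∂ₖ t = -Γₖ t` for every `k`. Let `i` be the first
direction and `j` the second. A line in direction `i` with `x j ∉ C₂` never meets the closed set, so
on it the given section is the parallel transport of its values where `x i < b₁`. There the section
is continuous, and transport is continuous in all variables, so the section extends continuously
across the closed set (`exists_continuous_extension`). The extension is unique because the points
with `x j ∉ C₂` are dense.

It remains to see that the continuous extension `t` is parallel. For `k ≠ j`, the lines in direction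
`k` with `x j ∉ C₂` are dense and consist of good points; the integrated form of the equation, "`t`
is constant in a parallel frame", is a closed condition and so passes to all lines
(`lineParallelAt_of_dense`). The three cases differ in the direction `j`.

(i) A discrete `C₂` is countable, and a continuous function whose derivative vanishes off a
countable set is constant (`lineParallelAt_of_countable`). (iii) The dense-lines argument applies to
direction `j` with the lines `x i ∉ C₁`. (ii) The curvature kills `t` on a dense set, hence
everywhere. Therefore the remainder `t(z + τ eⱼ) - t(z) + τ Γⱼ t(z)` solves the transport equation
in direction `i` up to an error `o(τ)`; being `o(τ)` at one point of an `i`-line, it is so further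
along, and parallelism spreads from `x i < b₁` (`LineFrame.lineParallelAt_propagate`). Finally,
continuous partial derivatives give differentiability, and `dt = -Γ t` makes `t` of class `C¹`. -/

/-! ### Differentiability from continuous partial derivatives -/

section Analysis

open Set Filter Topology Metric

variable {n : ℕ} {F : Type*} [NormedAddCommGroup F] [NormedSpace ℝ F]

/-- The `i`-th standard basis vector of `ℝⁿ`. -/
noncomputable abbrev stdVec {n : ℕ} (i : Fin n) : EuclideanSpace ℝ (Fin n) :=
  EuclideanSpace.single i (1 : ℝ)

theorem norm_stdVec (i : Fin n) : ‖stdVec i‖ = 1 := by simp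

theorem HasLineDerivAt.hasDerivAt_line {f : EuclideanSpace ℝ (Fin n) → F} {f' : F}
    {x v : EuclideanSpace ℝ (Fin n)} {τ : ℝ} (h : HasLineDerivAt ℝ f f' (x + τ • v) v) :
    HasDerivAt (fun σ : ℝ ↦ f (x + σ • v)) f' τ := by
  have h1 : HasDerivAt (fun σ : ℝ ↦ f (x + τ • v + σ • v)) f' (τ - τ) := by
    simpa [HasLineDerivAt] using h
  have := HasDerivAt.scomp (h := fun σ : ℝ ↦ σ - τ) τ h1 ((hasDerivAt_id τ).sub_const τ)
  simp only [one_smul] at this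
  refine this.congr_of_eventuallyEq (.of_forall fun σ ↦ ?_)
  simp only [Function.comp]
  congr 1
  module

/-- A function with partial derivatives near `x` that are continuous at `x` is differentiable. -/
theorem hasFDerivAt_of_hasLineDerivAt_stdVec {f : EuclideanSpace ℝ (Fin n) → F}
    {f' : EuclideanSpace ℝ (Fin n) → EuclideanSpace ℝ (Fin n) →L[ℝ] F}
    {x : EuclideanSpace ℝ (Fin n)} (hf' : ContinuousAt f' x)
    (hf : ∀ᶠ y in 𝓝 x, ∀ i, HasLineDerivAt ℝ f (f' y (stdVec i)) y (stdVec i)) :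
    HasFDerivAt f (f' x) x := by
  classical
  rw [hasFDerivAt_iff_isLittleO, Asymptotics.isLittleO_iff]
  intro c hc
  -- There are `n` coordinate steps, each with error `ε * ‖y - x‖`; `n + 1` also covers `n = 0`.
  set ε : ℝ := c / (n + 1) with hε
  have hεpos : 0 < ε := by positivity
  obtain ⟨δ, hδ, hball⟩ := Metric.eventually_nhds_iff_ball.1
    (hf.and (Metric.continuousAt_iff'.1 hf' ε hεpos))
  have hδ' : 0 < δ / (n + 1) := by positivity
  filter_upwards [Metric.ball_mem_nhds x hδ'] with y hy
  have hyx : ‖y - x‖ < δ / (n + 1) := by simpa [dist_eq_norm] using hy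
  have hcoord : ∀ i, |y i - x i| ≤ ‖y - x‖ := fun i ↦ by
    simpa using PiLp.norm_apply_le (y - x) i
  -- An axis-parallel path from `x` to `y`: the coordinates in `S` have already been moved. Each
  -- edge involves one partial derivative only, to which the mean value inequality applies.
  set P : Finset (Fin n) → EuclideanSpace ℝ (Fin n) :=
    fun S ↦ x + ∑ i ∈ S, (y i - x i) • stdVec i with hP
  have key : ∀ S : Finset (Fin n),
      ‖f (P S) - f x - f' x (P S - x)‖ ≤ S.card * (ε * ‖y - x‖) := by
    intro S
    induction S using Finset.induction_on with
    | empty => simp [hP]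
    | insert i S hi ih =>
      have hPi : P (insert i S) = P S + (y i - x i) • stdVec i := by
        simp only [hP, Finset.sum_insert hi]; abel
      have hcard : (S.card : ℝ) + 1 ≤ n := by
        have := Finset.card_le_univ (insert i S)
        rw [Finset.card_insert_of_notMem hi, Fintype.card_fin] at this
        exact_mod_cast this
      have hmem : ∀ τ ∈ Icc (0 : ℝ) 1,
          P S + (τ * (y i - x i)) • stdVec i ∈ ball x δ := by
        intro τ hτ
        rw [mem_ball, dist_eq_norm]
        have h1 : ‖∑ i ∈ S, (y i - x i) • stdVec (n := n) i‖ ≤ S.card * ‖y - x‖ := by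
          refine (norm_sum_le _ _).trans ?_
          rw [← nsmul_eq_mul]
          refine Finset.sum_le_card_nsmul _ _ _ fun j _ ↦ ?_
          simpa [norm_smul] using hcoord j
        have h2 : ‖(τ * (y i - x i)) • stdVec (n := n) i‖ ≤ ‖y - x‖ := by
          have : |τ| ≤ 1 := abs_le.2 ⟨by linarith [hτ.1], hτ.2⟩
          simp only [norm_smul, Real.norm_eq_abs, abs_mul, norm_stdVec]
          nlinarith [hcoord i, abs_nonneg (y i - x i), abs_nonneg τ, norm_nonneg (y - x), abs_one (α := ℝ)]
        calc ‖P S + (τ * (y i - x i)) • stdVec i - x‖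
            = ‖∑ i ∈ S, (y i - x i) • stdVec (n := n) i + (τ * (y i - x i)) • stdVec i‖ := by
              simp only [hP]; congr 1; abel
          _ ≤ S.card * ‖y - x‖ + ‖y - x‖ := (norm_add_le _ _).trans (add_le_add h1 h2)
          _ = (S.card + 1) * ‖y - x‖ := by ring
          _ ≤ (n + 1) * ‖y - x‖ := mul_le_mul_of_nonneg_right (by linarith) (norm_nonneg _)
          _ < δ := by rwa [lt_div_iff₀' (by positivity)] at hyx
      have hd : ∀ τ ∈ Icc (0 : ℝ) 1, HasDerivWithinAt
          (fun τ : ℝ ↦ f (P S + (τ * (y i - x i)) • stdVec i)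
            - τ • (y i - x i) • f' x (stdVec i))
          ((y i - x i) • (f' (P S + (τ * (y i - x i)) • stdVec i) (stdVec i) - f' x (stdVec i)))
          (Icc 0 1) τ := by
        intro τ hτ
        have h1 := ((hball _ (hmem τ hτ)).1 i).hasDerivAt_line
        have h2 := h1.scomp τ ((hasDerivAt_id τ).mul_const (y i - x i))
        have h3 := h2.sub ((hasDerivAt_id τ).smul_const ((y i - x i) • f' x (stdVec i)))
        convert! h3.hasDerivWithinAt using 1
        simp [smul_sub]
      have hb : ∀ τ ∈ Ico (0 : ℝ) 1,
          ‖(y i - x i) • (f' (P S + (τ * (y i - x i)) • stdVec i) (stdVec i)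
            - f' x (stdVec i))‖ ≤ ε * ‖y - x‖ := by
        intro τ hτ
        have h1 := (hball _ (hmem τ ⟨hτ.1, hτ.2.le⟩)).2
        rw [dist_eq_norm] at h1
        have h2 := ContinuousLinearMap.le_opNorm
          (f' (P S + (τ * (y i - x i)) • stdVec i) - f' x) (stdVec i)
        rw [norm_stdVec, mul_one, sub_apply] at h2
        rw [norm_smul, mul_comm, Real.norm_eq_abs]
        exact mul_le_mul (h2.trans h1.le) (hcoord i) (abs_nonneg _) hεpos.le
      have hmv := norm_image_sub_le_of_norm_deriv_le_segment_01' hd hb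
      simp only [one_mul, one_smul, zero_mul, zero_smul, add_zero, sub_zero] at hmv
      rw [← hPi] at hmv
      have heq : f (P (insert i S)) - f x - f' x (P (insert i S) - x)
          = (f (P S) - f x - f' x (P S - x))
            + (f (P (insert i S)) - (y i - x i) • f' x (stdVec i) - f (P S)) := by
        rw [show P (insert i S) - x = (P S - x) + (y i - x i) • stdVec i by rw [hPi]; abel,
          map_add, map_smul]
        abel
      rw [heq, Finset.card_insert_of_notMem hi]
      push_cast
      refine (norm_add_le _ _).trans ?_
      linarith
  have hPuniv : P Finset.univ = y := by
    have : ∑ i, (y i - x i) • stdVec i = y - x := by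
      ext j
      simp [Finset.sum_apply, Pi.single_apply]
    simp only [hP, this]; abel
  have := key Finset.univ
  rw [hPuniv, Finset.card_univ, Fintype.card_fin] at this
  refine this.trans ?_
  have h1 : (n : ℝ) * ε ≤ c := by
    rw [hε, mul_div_assoc', div_le_iff₀ (by positivity)]; nlinarith
  nlinarith [norm_nonneg (y - x)]

end Analysis

/-! ### Parallel frames along a coordinate direction -/

section Frames

open Set Filter Topology Metric

variable {n : ℕ} {R : Type*} [NormedRing R] [NormedAlgebra ℝ R] [CompleteSpace R]


/-- The point `x` with its `i`-th coordinate replaced by `ξ`. -/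
noncomputable def setCoord {n : ℕ} (i : Fin n) (x : EuclideanSpace ℝ (Fin n)) (ξ : ℝ) :
    EuclideanSpace ℝ (Fin n) :=
  x + (ξ - x i) • stdVec i

theorem setCoord_apply_same (i : Fin n) (x : EuclideanSpace ℝ (Fin n)) (ξ : ℝ) :
    setCoord i x ξ i = ξ := by
  simp [setCoord]

theorem setCoord_apply_of_ne {i j : Fin n} (hij : j ≠ i) (x : EuclideanSpace ℝ (Fin n)) (ξ : ℝ) :
    setCoord i x ξ j = x j := by
  simp [setCoord, hij]

theorem setCoord_self (i : Fin n) (x : EuclideanSpace ℝ (Fin n)) : setCoord i x (x i) = x := by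
  simp [setCoord]

theorem setCoord_add_smul (i : Fin n) (x : EuclideanSpace ℝ (Fin n)) (ξ τ : ℝ) :
    setCoord i (x + τ • stdVec i) ξ = setCoord i x ξ := by
  ext j
  by_cases h : j = i
  · subst h; simp [setCoord_apply_same]
  · simp [setCoord_apply_of_ne h, h]

theorem continuous_setCoord (i : Fin n) :
    Continuous fun p : EuclideanSpace ℝ (Fin n) × ℝ ↦ setCoord i p.1 p.2 := by
  unfold setCoord
  fun_prop

/-- Local solvability of `∂ᵢ g = -A g` by the contraction principle, continuously in all
variables. -/
theorem exists_solution_of_bounded (i : Fin n) (p : EuclideanSpace ℝ (Fin n))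
    (A : BoundedContinuousFunction (EuclideanSpace ℝ (Fin n)) R) :
    ∃ r > 0, ∃ g : EuclideanSpace ℝ (Fin n) → R, Continuous g ∧ g p = 1 ∧
      ∀ x ∈ ball p r, HasLineDerivAt ℝ g (-(A x * g x)) x (stdVec i) := by
  -- Chosen so that integration over length `r` against `A` is a contraction with constant `1 / 2`.
  set r : ℝ := 1 / (2 * (‖A‖ + 1)) with hr
  have hrpos : 0 < r := by positivity
  have hrA : r * ‖A‖ ≤ 1 / 2 := by
    rw [hr, div_mul_eq_mul_div, div_le_iff₀ (by positivity)]
    linarith [norm_nonneg A]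
  have hle : p i - r ≤ p i + r := by linarith
  -- Clamping the upper limit lets the Picard operator act on bounded continuous functions on all of
  -- `ℝⁿ`. The other coordinates are parameters, so the fixed point is jointly continuous; on the
  -- ball the clamp is inactive.
  let cl : EuclideanSpace ℝ (Fin n) → ℝ := fun x ↦ projIcc (p i - r) (p i + r) hle (x i)
  have hcl : Continuous cl := by
    have : Continuous fun x : EuclideanSpace ℝ (Fin n) ↦ x i := by fun_prop
    exact continuous_subtype_val.comp (continuous_projIcc.comp this)
  have hclb : ∀ x, |cl x - p i| ≤ r := fun x ↦ by
    have := (projIcc (p i - r) (p i + r) hle (x i)).2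
    exact abs_le.2 ⟨by linarith [this.1], by linarith [this.2]⟩
  let I : BoundedContinuousFunction (EuclideanSpace ℝ (Fin n)) R → EuclideanSpace ℝ (Fin n) → R :=
    fun g x ↦ ∫ ξ in (p i)..(cl x), A (setCoord i x ξ) * g (setCoord i x ξ)
  have hφ : ∀ g : BoundedContinuousFunction (EuclideanSpace ℝ (Fin n)) R,
      Continuous fun q : EuclideanSpace ℝ (Fin n) × ℝ ↦
        A (setCoord i q.1 q.2) * g (setCoord i q.1 q.2) := fun g ↦
    (A.continuous.comp (continuous_setCoord i)).mul (g.continuous.comp (continuous_setCoord i))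
  have hIc : ∀ g, Continuous (I g) := fun g ↦
    intervalIntegral.continuous_parametric_intervalIntegral_of_continuous (hφ g) hcl
  have hIb : ∀ g x, ‖I g x‖ ≤ 1 / 2 * ‖g‖ := by
    intro g x
    have h1 : ‖I g x‖ ≤ (‖A‖ * ‖g‖) * |cl x - p i| :=
      intervalIntegral.norm_integral_le_of_norm_le_const fun ξ _ ↦
        (norm_mul_le _ _).trans (mul_le_mul (A.norm_coe_le_norm _) (g.norm_coe_le_norm _)
          (norm_nonneg _) (norm_nonneg _))
    have h2 : (‖A‖ * ‖g‖) * |cl x - p i| ≤ (‖A‖ * ‖g‖) * r := by gcongr; exact hclb x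
    nlinarith [norm_nonneg g]
  have hIsub : ∀ g g' x, I g x - I g' x = I (g - g') x := by
    intro g g' x
    simp only [I]
    rw [← intervalIntegral.integral_sub]
    · simp [mul_sub]
    · exact ((hφ g).comp (by fun_prop : Continuous fun ξ : ℝ ↦ (x, ξ))).intervalIntegrable _ _
    · exact ((hφ g').comp (by fun_prop : Continuous fun ξ : ℝ ↦ (x, ξ))).intervalIntegrable _ _
  let T : BoundedContinuousFunction (EuclideanSpace ℝ (Fin n)) R →
      BoundedContinuousFunction (EuclideanSpace ℝ (Fin n)) R := fun g ↦
    BoundedContinuousFunction.ofNormedAddCommGroup (fun x ↦ 1 - I g x)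
      (continuous_const.sub (hIc g)) (‖(1 : R)‖ + 1 / 2 * ‖g‖) fun x ↦
        (norm_sub_le _ _).trans (by gcongr; exact hIb g x)
  have hT : ContractingWith (1 / 2) T := by
    refine ⟨by norm_num [← NNReal.coe_lt_coe], LipschitzWith.of_dist_le_mul fun g g' ↦ ?_⟩
    rw [BoundedContinuousFunction.dist_le (by positivity)]
    intro x
    rw [dist_eq_norm, dist_eq_norm]
    have : T g x - T g' x = I (g' - g) x := by
      rw [← hIsub]; simp [T]
    rw [this, norm_sub_rev g g']
    simpa using hIb (g' - g) x
  obtain ⟨g, hg⟩ : ∃ g, T g = g := ⟨_, hT.fixedPoint_isFixedPt⟩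
  have hgx : ∀ x, g x = 1 - I g x := fun x ↦ (DFunLike.congr_fun hg x).symm
  have hclx : ∀ x ∈ ball p r, cl x = x i := by
    intro x hx
    have h1 : |x i - p i| ≤ ‖x - p‖ := by simpa using PiLp.norm_apply_le (x - p) i
    have h2 : ‖x - p‖ < r := by simpa [dist_eq_norm] using hx
    have h3 := abs_le.1 (h1.trans h2.le)
    simp only [cl]
    rw [projIcc_of_mem hle ⟨by linarith [h3.1], by linarith [h3.2]⟩]
  refine ⟨r, hrpos, g, g.continuous, ?_, fun x hx ↦ ?_⟩
  · rw [hgx]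
    simp only [I]
    rw [hclx p (mem_ball_self hrpos)]
    simp
  · have hφx : Continuous fun ξ : ℝ ↦ A (setCoord i x ξ) * g (setCoord i x ξ) :=
      (hφ g).comp (by fun_prop : Continuous fun ξ : ℝ ↦ (x, ξ))
    have h1 : HasDerivAt (fun y ↦ ∫ ξ in (p i)..y, A (setCoord i x ξ) * g (setCoord i x ξ))
        (A x * g x) (x i + 0) := by
      have := intervalIntegral.integral_hasDerivAt_right (hφx.intervalIntegrable (p i) (x i))
        (hφx.stronglyMeasurableAtFilter _ _) hφx.continuousAt
      simpa [setCoord_self] using this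
    have h2 : HasDerivAt (fun τ : ℝ ↦ x i + τ) 1 0 := (hasDerivAt_id (0 : ℝ)).const_add (x i)
    have h3 := (HasDerivAt.scomp (h := fun τ : ℝ ↦ x i + τ) 0 h1 h2).const_sub (1 : R)
    rw [one_smul] at h3
    refine HasDerivAt.congr_of_eventuallyEq h3 ?_
    have h4 : ∀ᶠ τ : ℝ in 𝓝 0, x + τ • stdVec i ∈ ball p r := by
      have : Continuous fun τ : ℝ ↦ x + τ • stdVec i := by fun_prop
      exact this.continuousAt.eventually_mem (isOpen_ball.mem_nhds (by simpa using hx))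
    filter_upwards [h4] with τ hτ
    rw [hgx]
    simp only [I, Function.comp]
    rw [hclx _ hτ]
    simp [setCoord_add_smul]

theorem HasDerivAt.ringInverse {f : ℝ → R} {f' : R} {τ : ℝ} (hf : HasDerivAt f f' τ)
    (hu : IsUnit (f τ)) :
    HasDerivAt (fun σ ↦ Ring.inverse (f σ))
      (-(Ring.inverse (f τ) * f' * Ring.inverse (f τ))) τ := by
  obtain ⟨u, hu⟩ := hu
  have h1 := hasFDerivAt_ringInverse (𝕜 := ℝ) u
  rw [hu] at h1
  refine (h1.comp_hasDerivAt τ hf).congr_deriv ?_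
  rw [← hu, Ring.inverse_unit]
  rfl

/-- A frame along the `i`-th coordinate direction for the linear differential equation
`∂ᵢ t = -A t`, on a ball around `p`, together with its inverse. -/
structure LineFrame (i : Fin n) (A : EuclideanSpace ℝ (Fin n) → R)
    (p : EuclideanSpace ℝ (Fin n)) (r : ℝ) where
  g : EuclideanSpace ℝ (Fin n) → R
  h : EuclideanSpace ℝ (Fin n) → R
  continuousOn_g : ContinuousOn g (ball p r)
  continuousOn_h : ContinuousOn h (ball p r)
  g_mul_h : ∀ x ∈ ball p r, g x * h x = 1
  hasLineDerivAt_g : ∀ x ∈ ball p r, HasLineDerivAt ℝ g (-(A x * g x)) x (stdVec i)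
  hasLineDerivAt_h : ∀ x ∈ ball p r, HasLineDerivAt ℝ h (h x * A x) x (stdVec i)

/-- Frames along the `i`-th direction exist locally. -/
theorem exists_lineFrame [FiniteDimensional ℝ R] (i : Fin n) {A : EuclideanSpace ℝ (Fin n) → R}
    {Ω : Set (EuclideanSpace ℝ (Fin n))} (hΩ : IsOpen Ω) (hA : ContinuousOn A Ω)
    {p : EuclideanSpace ℝ (Fin n)} (hp : p ∈ Ω) :
    ∃ r > 0, ball p r ⊆ Ω ∧ Nonempty (LineFrame i A p r) := by
  obtain ⟨r₀, hr₀, hball⟩ := Metric.nhds_basis_closedBall.mem_iff.1 (hΩ.mem_nhds hp)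
  have : CompactSpace (closedBall p r₀) := isCompact_iff_compactSpace.1 (isCompact_closedBall p r₀)
  let A₀ : BoundedContinuousFunction (closedBall p r₀) R :=
    BoundedContinuousFunction.mkOfCompact ⟨_, (hA.mono hball).domRestrict⟩
  -- Tietze extension: `A` is continuous only on `Ω`, whereas the contraction argument needs a
  -- bounded coefficient on `ℝⁿ`.
  obtain ⟨A₁, -, hA₁⟩ := BoundedContinuousFunction.exists_norm_eq_domRestrict_eq (𝕜 := ℝ)
    isClosed_closedBall A₀
  have hA₁x : ∀ x ∈ closedBall p r₀, A₁ x = A x := fun x hx ↦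
    DFunLike.congr_fun hA₁ ⟨x, hx⟩
  obtain ⟨r₁, hr₁, g, hgc, hgp, hg⟩ := exists_solution_of_bounded i p A₁
  have hunit : ∀ᶠ x in 𝓝 p, IsUnit (g x) :=
    hgc.continuousAt.eventually_mem (Units.isOpen.mem_nhds (by simp [hgp]))
  obtain ⟨r₂, hr₂, hr₂u⟩ := Metric.eventually_nhds_iff_ball.1 hunit
  have hb₀ : ball p (min r₀ (min r₁ r₂)) ⊆ closedBall p r₀ :=
    (ball_subset_ball (min_le_left _ _)).trans ball_subset_closedBall
  have hb₁ : ball p (min r₀ (min r₁ r₂)) ⊆ ball p r₁ :=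
    ball_subset_ball ((min_le_right _ _).trans (min_le_left _ _))
  have hb₂ : ball p (min r₀ (min r₁ r₂)) ⊆ ball p r₂ :=
    ball_subset_ball ((min_le_right _ _).trans (min_le_right _ _))
  have hder : ∀ x ∈ ball p (min r₀ (min r₁ r₂)),
      HasLineDerivAt ℝ g (-(A x * g x)) x (stdVec i) := fun x hx ↦ by
    rw [← hA₁x x (hb₀ hx)]; exact hg x (hb₁ hx)
  refine ⟨min r₀ (min r₁ r₂), by positivity, hb₀.trans hball, ⟨⟨g, fun x ↦ Ring.inverse (g x),
    hgc.continuousOn, fun x hx ↦ ?_, fun x hx ↦ ?_, hder, fun x hx ↦ ?_⟩⟩⟩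
  · obtain ⟨u, hu⟩ := hr₂u x (hb₂ hx)
    have := NormedRing.inverse_continuousAt u
    rw [hu] at this
    exact (ContinuousAt.comp this hgc.continuousAt).continuousWithinAt
  · exact Ring.mul_inverse_cancel _ (hr₂u x (hb₂ hx))
  · obtain ⟨u, hu⟩ := hr₂u x (hb₂ hx)
    have h2 : HasDerivAt (fun τ : ℝ ↦ g (x + τ • stdVec i)) (-(A x * g x)) 0 := hder x hx
    have h0 : x + (0 : ℝ) • stdVec i = x := by rw [zero_smul, add_zero]
    have h3 := h2.ringInverse (by rw [h0, ← hu]; exact u.isUnit)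
    refine (h3.congr_deriv ?_ : HasDerivAt _ _ _)
    rw [h0, ← hu, Ring.inverse_unit, mul_neg, neg_mul, neg_neg, mul_assoc, mul_assoc,
      Units.mul_inv, mul_one]

end Frames

/-! ### Parallel transport along coordinate lines -/

section Transport

open Set Filter Topology Metric

variable {n : ℕ} {F : Type*} [NormedAddCommGroup F] [NormedSpace ℝ F]

/-- `t` satisfies `∂ᵢ t = -A t` at `x`. -/
abbrev LineParallelAt {n : ℕ} {F : Type*} [NormedAddCommGroup F] [NormedSpace ℝ F] (i : Fin n)
    (A : EuclideanSpace ℝ (Fin n) → F →L[ℝ] F)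
    (t : EuclideanSpace ℝ (Fin n) → F) (x : EuclideanSpace ℝ (Fin n)) : Prop :=
  HasLineDerivAt ℝ t (-(A x (t x))) x (stdVec i)

theorem add_smul_mem_ball {p x v : EuclideanSpace ℝ (Fin n)} {r a τ : ℝ} (hx : x ∈ ball p r)
    (hxa : x + a • v ∈ ball p r) (hτ : τ ∈ uIcc 0 a) : x + τ • v ∈ ball p r := by
  obtain ⟨θ, hθ, rfl⟩ : ∃ θ ∈ Icc (0 : ℝ) 1, θ * a = τ := by
    rw [← segment_eq_uIcc, segment_eq_image] at hτ
    obtain ⟨θ, hθ, h⟩ := hτ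
    exact ⟨θ, hθ, by simpa using h⟩
  have := (convex_ball p r) hx hxa (sub_nonneg.2 hθ.2) hθ.1 (by ring)
  convert this using 1
  module

variable {i : Fin n} {A : EuclideanSpace ℝ (Fin n) → F →L[ℝ] F} {p : EuclideanSpace ℝ (Fin n)}
  {r : ℝ}

namespace LineFrame

theorem g_h_apply (fr : LineFrame i A p r) {x : EuclideanSpace ℝ (Fin n)} (hx : x ∈ ball p r)
    (v : F) : fr.g x (fr.h x v) = v :=
  DFunLike.congr_fun (fr.g_mul_h x hx) v

/-- In a parallel frame the operator `∂ᵢ + A` becomes `∂ᵢ`. -/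
theorem hasDerivAt_h_apply (fr : LineFrame i A p r) {t : EuclideanSpace ℝ (Fin n) → F} {ρ : F}
    {x : EuclideanSpace ℝ (Fin n)} {τ : ℝ} (hx : x + τ • stdVec i ∈ ball p r)
    (ht : HasLineDerivAt ℝ t (-(A (x + τ • stdVec i) (t (x + τ • stdVec i))) + ρ)
      (x + τ • stdVec i) (stdVec i)) :
    HasDerivAt (fun σ : ℝ ↦ fr.h (x + σ • stdVec i) (t (x + σ • stdVec i)))
      (fr.h (x + τ • stdVec i) ρ) τ := by
  have h1 := (fr.hasLineDerivAt_h _ hx).hasDerivAt_line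
  refine (h1.clm_apply ht.hasDerivAt_line).congr_deriv ?_
  simp

/-- Parallel transport along the `i`-th direction, allowing for countably many exceptional
points. -/
theorem transport [FiniteDimensional ℝ F] (fr : LineFrame i A p r)
    {t : EuclideanSpace ℝ (Fin n) → F}
    {x : EuclideanSpace ℝ (Fin n)} {a : ℝ} (hx : x ∈ ball p r)
    (hxa : x + a • stdVec i ∈ ball p r)
    (htc : ContinuousOn (fun τ : ℝ ↦ t (x + τ • stdVec i)) (uIcc 0 a))
    {N : Set ℝ} (hN : N.Countable)
    (ht : ∀ τ ∈ uIcc 0 a, τ ∉ N → LineParallelAt i A t (x + τ • stdVec i)) :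
    fr.h (x + a • stdVec i) (t (x + a • stdVec i)) = fr.h x (t x) := by
  have hmaps : MapsTo (fun τ : ℝ ↦ x + τ • stdVec i) (uIcc 0 a) (ball p r) :=
    fun τ hτ ↦ add_smul_mem_ball hx hxa hτ
  have hline : ContinuousOn (fun τ : ℝ ↦ x + τ • stdVec (n := n) i) (uIcc 0 a) := by fun_prop
  have hc : ContinuousOn (fun τ : ℝ ↦ fr.h (x + τ • stdVec i) (t (x + τ • stdVec i)))
      (uIcc 0 a) :=
    (fr.continuousOn_h.comp hline hmaps).clm_apply htc
  -- In the frame, parallelism means derivative zero. The fundamental theorem of calculus for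
  -- continuous functions tolerates a countable exceptional set; a Cantor function shows that
  -- nowhere dense would not do.
  have := MeasureTheory.integral_eq_of_hasDerivAt_off_countable _ (fun _ ↦ (0 : F)) hN hc
    (fun τ hτ ↦ by
      have hτ' : τ ∈ uIcc 0 a := ⟨hτ.1.1.le, hτ.1.2.le⟩
      have := fr.hasDerivAt_h_apply (ρ := 0) (hmaps hτ') (by simpa using ht τ hτ' hτ.2)
      simpa using this) (by simp)
  simp only [intervalIntegral.integral_zero, zero_smul, add_zero] at this
  exact sub_eq_zero.1 this.symm

/-- Converse of `transport`: `t` is then `g` applied to a constant vector, which solves the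
equation. Differentiability of `t` is a conclusion here, so limits of transport identities suffice
later. -/
theorem lineParallelAt_of_eventually_const (fr : LineFrame i A p r)
    {t : EuclideanSpace ℝ (Fin n) → F} {x : EuclideanSpace ℝ (Fin n)} (hx : x ∈ ball p r)
    (ht : ∀ᶠ τ : ℝ in 𝓝 0, fr.h (x + τ • stdVec i) (t (x + τ • stdVec i)) = fr.h x (t x)) :
    LineParallelAt i A t x := by
  have h1 : HasDerivAt (fun τ : ℝ ↦ fr.g (x + τ • stdVec i) (fr.h x (t x)))
      (-(A x (t x))) 0 := by
    have h2 : HasDerivAt (fun τ : ℝ ↦ fr.g (x + τ • stdVec i)) (-(A x * fr.g x)) 0 :=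
      fr.hasLineDerivAt_g x hx
    refine (h2.clm_apply (hasDerivAt_const (0 : ℝ) (fr.h x (t x)))).congr_deriv ?_
    simp [fr.g_h_apply hx]
  refine HasDerivAt.congr_of_eventuallyEq h1 ?_
  have h4 : ∀ᶠ τ : ℝ in 𝓝 0, x + τ • stdVec i ∈ ball p r := by
    have : Continuous fun τ : ℝ ↦ x + τ • stdVec i := by fun_prop
    exact this.continuousAt.eventually_mem (isOpen_ball.mem_nhds (by simpa using hx))
  filter_upwards [ht, h4] with τ hτ hτ'
  rw [← hτ, fr.g_h_apply hτ']

end LineFrame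

/-- A continuous solution of `∂ᵢ t = -Γᵢ t` for all `i` is differentiable, with `dt = -Γ t`. -/
theorem hasFDerivAt_of_lineParallelAt {t : EuclideanSpace ℝ (Fin n) → F}
    {Ω : Set (EuclideanSpace ℝ (Fin n))}
    {Γ : EuclideanSpace ℝ (Fin n) → EuclideanSpace ℝ (Fin n) →L[ℝ] F →L[ℝ] F}
    (hΩ : IsOpen Ω) (hΓ : ContinuousOn Γ Ω) (ht : ContinuousOn t Ω)
    (h : ∀ x ∈ Ω, ∀ i, LineParallelAt i (fun y ↦ Γ y (stdVec i)) t x)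
    {x : EuclideanSpace ℝ (Fin n)} (hx : x ∈ Ω) :
    HasFDerivAt t (-(Γ x).flip (t x)) x := by
  refine hasFDerivAt_of_hasLineDerivAt_stdVec (f' := fun y ↦ -(Γ y).flip (t y)) ?_ ?_
  · have h1 : ContinuousOn (fun y ↦ (Γ y).flip) Ω :=
      (ContinuousLinearMap.flipₗᵢ ℝ (EuclideanSpace ℝ (Fin n)) F F).continuous.comp_continuousOn hΓ
    exact (h1.clm_apply ht).neg.continuousAt (hΩ.mem_nhds hx)
  · filter_upwards [hΩ.mem_nhds hx] with y hy i
    simpa using h y hy i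

variable [FiniteDimensional ℝ F] {t : EuclideanSpace ℝ (Fin n) → F}
  {Ω : Set (EuclideanSpace ℝ (Fin n))}

/-- A continuous function that satisfies `∂ᵢ t = -A t` at all but countably many points of a line
satisfies it everywhere on the line. -/
theorem lineParallelAt_of_countable (hΩ : IsOpen Ω) (hA : ContinuousOn A Ω)
    (ht : ContinuousOn t Ω) {x : EuclideanSpace ℝ (Fin n)} (hx : x ∈ Ω) {N : Set ℝ}
    (hN : N.Countable)
    (h : ∀ τ : ℝ, τ ∉ N → x + τ • stdVec i ∈ Ω → LineParallelAt i A t (x + τ • stdVec i)) :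
    LineParallelAt i A t x := by
  obtain ⟨r, hr, hball, ⟨fr⟩⟩ := exists_lineFrame i hΩ hA hx
  refine fr.lineParallelAt_of_eventually_const (mem_ball_self hr) ?_
  have h4 : ∀ᶠ τ : ℝ in 𝓝 0, x + τ • stdVec i ∈ ball x r := by
    have : Continuous fun τ : ℝ ↦ x + τ • stdVec i := by fun_prop
    exact this.continuousAt.eventually_mem (isOpen_ball.mem_nhds (by simpa using hr))
  filter_upwards [h4] with τ hτ
  exact fr.transport (mem_ball_self hr) hτ (ht.comp (by fun_prop) fun σ hσ ↦
    hball (add_smul_mem_ball (mem_ball_self hr) hτ hσ)) hN fun σ hσ hσN ↦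
    h σ hσN (hball (add_smul_mem_ball (mem_ball_self hr) hτ hσ))

/-- A continuous function that satisfies `∂ᵢ t = -A t` on a dense set of lines satisfies it
everywhere. -/
theorem lineParallelAt_of_dense (hΩ : IsOpen Ω) (hA : ContinuousOn A Ω)
    (ht : ContinuousOn t Ω) {D : Set (EuclideanSpace ℝ (Fin n))} (hD : Ω ⊆ closure D)
    (hDi : ∀ x ∈ D, ∀ τ : ℝ, x + τ • stdVec i ∈ D)
    (h : ∀ x ∈ D, x ∈ Ω → LineParallelAt i A t x) {x : EuclideanSpace ℝ (Fin n)} (hx : x ∈ Ω) :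
    LineParallelAt i A t x := by
  obtain ⟨r, hr, hball, ⟨fr⟩⟩ := exists_lineFrame i hΩ hA hx
  refine fr.lineParallelAt_of_eventually_const (mem_ball_self hr) ?_
  have h4 : ∀ᶠ τ : ℝ in 𝓝 0, x + τ • stdVec i ∈ ball x r := by
    have : Continuous fun τ : ℝ ↦ x + τ • stdVec i := by fun_prop
    exact this.continuousAt.eventually_mem (isOpen_ball.mem_nhds (by simpa using hr))
  filter_upwards [h4] with τ hτ
  have hu : ∀ y ∈ ball x r, ContinuousAt (fun z ↦ fr.h z (t z)) y := fun y hy ↦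
    (fr.continuousOn_h.clm_apply (ht.mono hball)).continuousAt (isOpen_ball.mem_nhds hy)
  have hshift : Continuous fun y : EuclideanSpace ℝ (Fin n) ↦ y + τ • stdVec i := by fun_prop
  have hcont : ContinuousAt (fun y ↦ fr.h (y + τ • stdVec i) (t (y + τ • stdVec i))
      - fr.h y (t y)) x :=
    (ContinuousAt.comp (f := fun y ↦ y + τ • stdVec i) (hu _ hτ) hshift.continuousAt).sub
      (hu x (mem_ball_self hr))
  -- For fixed `τ` the transport identity is a closed condition on the base point, and it holds on
  -- the dense set `D`.
  have hfreq : ∃ᶠ y in 𝓝 x, fr.h (y + τ • stdVec i) (t (y + τ • stdVec i))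
      - fr.h y (t y) ∈ ({0} : Set F) := by
    refine ((mem_closure_iff_frequently.1 (hD hx)).and_eventually
      ((isOpen_ball.eventually_mem (mem_ball_self hr)).and
        (hshift.continuousAt.eventually_mem (isOpen_ball.mem_nhds hτ)))).mono ?_
    rintro y ⟨hyD, hy, hyτ⟩
    exact sub_eq_zero.2 (fr.transport hy hyτ (ht.comp (by fun_prop) fun σ hσ ↦
      hball (add_smul_mem_ball hy hyτ hσ)) countable_empty fun σ hσ _ ↦
      h _ (hDi y hyD σ) (hball (add_smul_mem_ball hy hyτ hσ)))
  exact sub_eq_zero.1 (isClosed_singleton.mem_of_frequently_of_tendsto hfreq hcont)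

end Transport

/-! ### Curvature and the propagation of parallelism for `C¹` connections -/

section Propagation

open Set Filter Topology Metric

variable {n : ℕ} {F : Type*} [NormedAddCommGroup F] [NormedSpace ℝ F]
  {Ω : Set (EuclideanSpace ℝ (Fin n))} {t : EuclideanSpace ℝ (Fin n) → F}

/-- Strict differentiability makes the first-order expansion uniform in the base point near each
`z₀`, and compactness makes it uniform on `S`. This bounds the error term in the equation for the
remainder `Q` below. -/
theorem eventually_norm_difference_le {a : EuclideanSpace ℝ (Fin n) → F →L[ℝ] F}
    (hΩ : IsOpen Ω) (ha : ContDiffOn ℝ 1 a Ω) (ht : ContinuousOn t Ω)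
    {S : Set (EuclideanSpace ℝ (Fin n))} (hS : IsCompact S) (hSΩ : S ⊆ Ω)
    (v : EuclideanSpace ℝ (Fin n)) {ε : ℝ} (hε : 0 < ε) :
    ∀ᶠ τ : ℝ in 𝓝 0, ∀ z ∈ S,
      ‖(a (z + τ • v) - a z) (t (z + τ • v)) - τ • (fderiv ℝ a z v) (t z)‖ ≤ ε * |τ| := by
  refine hS.eventually_forall_of_forall_eventually fun z₀ hz₀ ↦ ?_
  have hz₀Ω := hΩ.mem_nhds (hSΩ hz₀)
  have hshift : Tendsto (fun q : ℝ × EuclideanSpace ℝ (Fin n) ↦ q.2 + q.1 • v) (𝓝 (0, z₀))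
      (𝓝 z₀) := by
    have : Continuous fun q : ℝ × EuclideanSpace ℝ (Fin n) ↦ q.2 + q.1 • v := by fun_prop
    simpa using this.tendsto (0, z₀)
  have hsnd : Tendsto (fun q : ℝ × EuclideanSpace ℝ (Fin n) ↦ q.2) (𝓝 (0, z₀)) (𝓝 z₀) :=
    continuous_snd.tendsto (0, z₀)
  have ht₀ := ht.continuousAt hz₀Ω
  have hstrict : HasStrictFDerivAt a (fderiv ℝ a z₀) z₀ :=
    (ha.contDiffAt hz₀Ω).hasStrictFDerivAt (by norm_num)
  -- The derivative is frozen at `z₀`: `h1` treats the increment of `a` by strict differentiability,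
  -- `h6` the cost of freezing and of replacing `t (z + τ • v)` by `t z`, by continuity.
  have h1 : (fun q : ℝ × EuclideanSpace ℝ (Fin n) ↦
      (a (q.2 + q.1 • v) - a q.2 - q.1 • fderiv ℝ a z₀ v) (t (q.2 + q.1 • v)))
      =o[𝓝 (0, z₀)] fun q ↦ q.1 := by
    have h2 := hstrict.isLittleO.comp_tendsto (hshift.prodMk_nhds hsnd)
    have h3 : (fun q : ℝ × EuclideanSpace ℝ (Fin n) ↦
        a (q.2 + q.1 • v) - a q.2 - q.1 • fderiv ℝ a z₀ v) =o[𝓝 (0, z₀)] fun q ↦ q.1 := by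
      refine Asymptotics.IsLittleO.trans_isBigO (g := fun q ↦ q.1 • v) ?_ ?_
      · refine h2.congr (fun q ↦ ?_) fun q ↦ ?_ <;> simp
      · refine Asymptotics.IsBigO.of_bound ‖v‖ (.of_forall fun q ↦ ?_)
        rw [norm_smul, mul_comm]
    have h4 : (fun q : ℝ × EuclideanSpace ℝ (Fin n) ↦ t (q.2 + q.1 • v))
        =O[𝓝 (0, z₀)] fun _ ↦ (1 : ℝ) := (ht₀.tendsto.comp hshift).isBigO_one ℝ
    have h5 : (fun q : ℝ × EuclideanSpace ℝ (Fin n) ↦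
        ‖a (q.2 + q.1 • v) - a q.2 - q.1 • fderiv ℝ a z₀ v‖ * ‖t (q.2 + q.1 • v)‖)
        =o[𝓝 (0, z₀)] fun q ↦ q.1 * 1 := h3.norm_left.mul_isBigO h4.norm_left
    simp only [mul_one] at h5
    refine Asymptotics.IsBigO.trans_isLittleO (.of_bound 1 (.of_forall fun q ↦ ?_)) h5
    rw [one_mul, norm_mul, norm_norm, norm_norm]
    exact ContinuousLinearMap.le_opNorm _ _
  have h6 : (fun q : ℝ × EuclideanSpace ℝ (Fin n) ↦
      q.1 • ((fderiv ℝ a z₀ v) (t (q.2 + q.1 • v)) - (fderiv ℝ a q.2 v) (t q.2)))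
      =o[𝓝 (0, z₀)] fun q ↦ q.1 := by
    have hD : ContinuousAt (fun z ↦ (fderiv ℝ a z v) (t z)) z₀ :=
      (((ha.continuousOn_fderiv_of_isOpen hΩ (by norm_num)).continuousAt hz₀Ω).clm_apply
        continuousAt_const).clm_apply ht₀
    have h7 : Tendsto (fun q : ℝ × EuclideanSpace ℝ (Fin n) ↦
        (fderiv ℝ a z₀ v) (t (q.2 + q.1 • v)) - (fderiv ℝ a q.2 v) (t q.2)) (𝓝 (0, z₀))
        (𝓝 0) := by
      have := (((fderiv ℝ a z₀ v).continuous.tendsto _).comp (ht₀.tendsto.comp hshift)).sub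
        (hD.tendsto.comp hsnd)
      simpa [Function.comp_def] using this
    have h8 := (Asymptotics.isBigO_refl (fun q : ℝ × EuclideanSpace ℝ (Fin n) ↦ q.1)
      (𝓝 (0, z₀))).smul_isLittleO ((Asymptotics.isLittleO_one_iff ℝ).2 h7)
    simpa using h8
  have h9 := (h1.add h6).def hε
  filter_upwards [h9] with q hq
  rw [Real.norm_eq_abs] at hq
  convert! hq using 2
  simp only [sub_apply, smul_apply, smul_sub]
  abel

theorem HasFDerivAt.clm_flip {E G : Type*} [NormedAddCommGroup E] [NormedSpace ℝ E]
    [NormedAddCommGroup G] [NormedSpace ℝ G] {f : E → G →L[ℝ] F →L[ℝ] F}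
    {f' : E →L[ℝ] G →L[ℝ] F →L[ℝ] F} {x : E} (hf : HasFDerivAt f f' x) :
    HasFDerivAt (fun y ↦ (f y).flip) ((ContinuousLinearMap.flipₗᵢ ℝ G F
      F).toContinuousLinearEquiv.toContinuousLinearMap ∘L f') x :=
  HasFDerivAt.comp (g := (ContinuousLinearMap.flipₗᵢ ℝ G F
    F).toContinuousLinearEquiv.toContinuousLinearMap) x
    (ContinuousLinearMap.hasFDerivAt _) hf

variable {Γ : EuclideanSpace ℝ (Fin n) → EuclideanSpace ℝ (Fin n) →L[ℝ] F →L[ℝ] F}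

set_option synthInstance.maxHeartbeats 400000 in
/-- The curvature of a connection of class `C¹` annihilates a continuous section that is parallel
on a dense open set. -/
theorem curvature_apply_eq (hΩ : IsOpen Ω) (hΓ : ContDiffOn ℝ 1 Γ Ω) (ht : ContinuousOn t Ω)
    {O : Set (EuclideanSpace ℝ (Fin n))} (hO : IsOpen O) (hOΩ : Ω ⊆ closure O)
    (hpar : ∀ x ∈ O, x ∈ Ω → HasFDerivAt t (-(Γ x).flip (t x)) x)
    (v w : EuclideanSpace ℝ (Fin n)) {x : EuclideanSpace ℝ (Fin n)} (hx : x ∈ Ω) :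
    (fderiv ℝ Γ x v w) (t x) - Γ x w (Γ x v (t x)) =
      (fderiv ℝ Γ x w v) (t x) - Γ x v (Γ x w (t x)) := by
  have hDΓ : ContinuousOn (fderiv ℝ Γ) Ω := hΓ.continuousOn_fderiv_of_isOpen hΩ (by norm_num)
  have hΓc := hΓ.continuousOn
  have hcont : ∀ v w, ContinuousOn (fun y ↦ (fderiv ℝ Γ y v w) (t y) - Γ y w (Γ y v (t y))) Ω := by
    intro v w
    refine ContinuousOn.sub ?_ ?_
    · exact ((hDΓ.clm_apply continuousOn_const).clm_apply continuousOn_const).clm_apply ht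
    · exact (hΓc.clm_apply continuousOn_const).clm_apply
        ((hΓc.clm_apply continuousOn_const).clm_apply ht)
  -- On `O` the equation `dt = -Γ t` can be differentiated once more, and the identity is the
  -- symmetry of the second derivative of `t`. It involves `t` undifferentiated, hence extends by
  -- continuity.
  have hon : ∀ y ∈ O, y ∈ Ω → (fderiv ℝ Γ y v w) (t y) - Γ y w (Γ y v (t y)) =
      (fderiv ℝ Γ y w v) (t y) - Γ y v (Γ y w (t y)) := by
    intro y hyO hyΩ
    have hΓy : HasFDerivAt Γ (fderiv ℝ Γ y) y :=
      ((hΓ.contDiffAt (hΩ.mem_nhds hyΩ)).differentiableAt (by norm_num)).hasFDerivAt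
    have hflip := hΓy.clm_flip
    have h2 := (hflip.clm_apply (hpar y hyO hyΩ)).neg
    have hev : ∀ᶠ z in 𝓝 y, HasFDerivAt t (-(Γ z).flip (t z)) z := by
      filter_upwards [hO.mem_nhds hyO, hΩ.mem_nhds hyΩ] with z h1 h2 using hpar z h1 h2
    have := second_derivative_symmetric_of_eventually hev h2 v w
    simp at this
    rw [← sub_eq_zero] at this ⊢
    rw [← neg_eq_zero, ← this]
    abel
  have hfreq : ∃ᶠ y in 𝓝 x, ((fderiv ℝ Γ y v w) (t y) - Γ y w (Γ y v (t y))) -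
      ((fderiv ℝ Γ y w v) (t y) - Γ y v (Γ y w (t y))) ∈ ({0} : Set F) :=
    ((mem_closure_iff_frequently.1 (hOΩ hx)).and_eventually (hΩ.mem_nhds hx)).mono
      fun y hy ↦ sub_eq_zero.2 (hon y hy.1 hy.2)
  exact sub_eq_zero.1 (isClosed_singleton.mem_of_frequently_of_tendsto hfreq
    (((hcont v w).sub (hcont w v)).continuousAt (hΩ.mem_nhds hx)))

set_option synthInstance.maxHeartbeats 400000 in
/-- For a connection of class `C¹` and a continuous section that is parallel on a dense open set
and everywhere in the `i`-th direction, being parallel in the `j`-th direction propagates along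
the `i`-th direction. -/
theorem LineFrame.lineParallelAt_propagate [FiniteDimensional ℝ F] {i : Fin n} (j : Fin n)
    (hΩ : IsOpen Ω) (hΓ : ContDiffOn ℝ 1 Γ Ω)
    (ht : ContinuousOn t Ω) {O : Set (EuclideanSpace ℝ (Fin n))} (hO : IsOpen O)
    (hOΩ : Ω ⊆ closure O) (hpar : ∀ x ∈ O, x ∈ Ω → HasFDerivAt t (-(Γ x).flip (t x)) x)
    (hi : ∀ x ∈ Ω, LineParallelAt i (fun y ↦ Γ y (stdVec i)) t x)
    {p : EuclideanSpace ℝ (Fin n)} {r : ℝ} (fr : LineFrame i (fun y ↦ Γ y (stdVec i)) p r)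
    (hball : ball p r ⊆ Ω) {x : EuclideanSpace ℝ (Fin n)} {a : ℝ} (hx : x ∈ ball p r)
    (hxa : x + a • stdVec i ∈ ball p r)
    (hj : LineParallelAt j (fun y ↦ Γ y (stdVec j)) t x) :
    LineParallelAt j (fun y ↦ Γ y (stdVec j)) t (x + a • stdVec i) := by
  have hΓat : ∀ z ∈ Ω, HasFDerivAt Γ (fderiv ℝ Γ z) z := fun z hz ↦
    ((hΓ.contDiffAt (hΩ.mem_nhds hz)).differentiableAt (by norm_num)).hasFDerivAt
  have hΓi : ContDiffOn ℝ 1 (fun y ↦ Γ y (stdVec i)) Ω := hΓ.clm_apply contDiffOn_const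
  have hΓifd : ∀ z ∈ Ω, ∀ v, fderiv ℝ (fun y ↦ Γ y (stdVec i)) z v
      = fderiv ℝ Γ z v (stdVec i) := fun z hz v ↦ by
    have := (hΓat z hz).clm_apply (hasFDerivAt_const (stdVec i) z)
    rw [this.fderiv]
    simp
  -- The expected value of `∂ⱼ t`. Its `i`-derivative contains `∂ᵢΓⱼ`, which the curvature identity
  -- trades for `∂ⱼΓᵢ`.
  set w : EuclideanSpace ℝ (Fin n) → F := fun z ↦ -(Γ z (stdVec j) (t z)) with hw
  have hwi : ∀ z ∈ Ω, HasLineDerivAt ℝ w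
      (-(Γ z (stdVec i) (w z)) - (fderiv ℝ Γ z (stdVec j) (stdVec i)) (t z)) z (stdVec i) := by
    intro z hz
    have h1 := ((hΓat z hz).clm_apply (hasFDerivAt_const (stdVec j) z)).hasLineDerivAt (stdVec i)
    have h2 : HasDerivAt _ _ _ := h1
    have h3 := (h2.clm_apply (hi z hz)).neg
    refine (h3.congr_deriv ?_ : HasDerivAt _ _ _)
    have hc := curvature_apply_eq hΩ hΓ ht hO hOΩ hpar (stdVec i) (stdVec j) hz
    rw [sub_eq_iff_eq_add] at hc
    simp [hw, hc]
  set S : Set (EuclideanSpace ℝ (Fin n)) := (fun σ : ℝ ↦ x + σ • stdVec i) '' uIcc 0 a with hS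
  have hScomp : IsCompact S := isCompact_uIcc.image (by fun_prop)
  have hSball : S ⊆ ball p r := by
    rintro _ ⟨σ, hσ, rfl⟩
    exact add_smul_mem_ball hx hxa hσ
  obtain ⟨C, hC⟩ := hScomp.exists_bound_of_continuousOn (fr.continuousOn_h.mono hSball)
  have hC0 : 0 ≤ C := (norm_nonneg _).trans (hC x ⟨0, by simp, by simp⟩)
  set Q : ℝ → EuclideanSpace ℝ (Fin n) → F :=
    fun τ z ↦ t (z + τ • stdVec j) - t z - τ • w z with hQ
  -- The remainder `Q τ` satisfies the transport equation with a source term that is exactly the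
  -- quantity estimated in `eventually_norm_difference_le`, so `o(τ)` uniformly on the segment `S`.
  have hQi : ∀ᶠ τ : ℝ in 𝓝 0, ∀ z ∈ S, HasLineDerivAt ℝ (Q τ)
      (-(Γ z (stdVec i) (Q τ z)) + -((Γ (z + τ • stdVec j) (stdVec i) - Γ z (stdVec i))
        (t (z + τ • stdVec j)) - τ • (fderiv ℝ Γ z (stdVec j) (stdVec i)) (t z))) z
          (stdVec i) := by
    have hev : ∀ᶠ τ : ℝ in 𝓝 0, ∀ z ∈ S, z + τ • stdVec j ∈ Ω := by
      refine hScomp.eventually_forall_of_forall_eventually fun z hz ↦ ?_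
      have : Continuous fun q : ℝ × EuclideanSpace ℝ (Fin n) ↦ q.2 + q.1 • stdVec j := by fun_prop
      exact this.continuousAt.eventually_mem (hΩ.mem_nhds (by simpa using hball (hSball hz)))
    filter_upwards [hev] with τ hτ z hz
    have h1 : HasDerivAt (fun σ : ℝ ↦ t (z + τ • stdVec j + σ • stdVec i)) _ 0 := hi _ (hτ z hz)
    have h2 : HasDerivAt (fun σ : ℝ ↦ t (z + σ • stdVec i)) _ 0 := hi z (hball (hSball hz))
    have h3 : HasDerivAt (fun σ : ℝ ↦ w (z + σ • stdVec i)) _ 0 := hwi z (hball (hSball hz))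
    have h4 := (h1.sub h2).sub (h3.const_smul τ)
    have h5 := h4.congr_of_eventuallyEq (f₁ := fun σ : ℝ ↦ Q τ (z + σ • stdVec i))
      (.of_forall fun σ ↦ by
        simp only [hQ, Pi.sub_apply, Pi.smul_apply]
        rw [add_right_comm])
    refine (h5.congr_deriv ?_ : HasDerivAt _ _ _)
    simp only [hQ, map_sub, map_smul, sub_apply, smul_sub, smul_neg]
    abel
  suffices hmain : (fun τ : ℝ ↦ Q τ (x + a • stdVec i)) =o[𝓝 0] fun τ ↦ τ by
    refine hasDerivAt_iff_isLittleO_nhds_zero.2 (hmain.congr_left fun τ ↦ ?_)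
    simp [hQ, hw]
  have hstart : (fun τ : ℝ ↦ Q τ x) =o[𝓝 0] fun τ ↦ τ := by
    refine (hasDerivAt_iff_isLittleO_nhds_zero.1 hj).congr_left fun τ ↦ ?_
    simp [hQ, hw]
  have hu : (fun τ : ℝ ↦ fr.h (x + a • stdVec i) (Q τ (x + a • stdVec i)) - fr.h x (Q τ x))
      =o[𝓝 0] fun τ ↦ τ := by
    rw [Asymptotics.isLittleO_iff]
    intro ε hε
    -- `C` bounds the frame on the segment and `|a|` is its length, so the mean value inequality
    -- multiplies the error by at most `C * |a|`.
    have hε' : 0 < ε / (C * |a| + 1) := by positivity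
    filter_upwards [hQi, eventually_norm_difference_le hΩ hΓi ht hScomp (hSball.trans hball)
      (stdVec j) hε'] with τ hτ hτ'
    have hd : ∀ σ ∈ uIcc 0 a, HasDerivWithinAt
        (fun σ : ℝ ↦ fr.h (x + σ • stdVec i) (Q τ (x + σ • stdVec i))) _ (uIcc 0 a) σ :=
      fun σ hσ ↦ (fr.hasDerivAt_h_apply (hSball ⟨σ, hσ, rfl⟩) (hτ _ ⟨σ, hσ, rfl⟩)).hasDerivWithinAt
    have hb := (convex_uIcc (0 : ℝ) a).norm_image_sub_le_of_norm_hasDerivWithin_le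
      (C := C * (ε / (C * |a| + 1) * |τ|)) hd (fun σ hσ ↦ by
        refine (ContinuousLinearMap.le_opNorm _ _).trans ?_
        rw [norm_neg]
        have h1 := hτ' _ ⟨σ, hσ, rfl⟩
        rw [hΓifd _ (hball (hSball ⟨σ, hσ, rfl⟩))] at h1
        exact mul_le_mul (hC _ ⟨σ, hσ, rfl⟩) h1 (norm_nonneg _) hC0) left_mem_uIcc right_mem_uIcc
    simp only [zero_smul, add_zero, sub_zero, Real.norm_eq_abs] at hb ⊢
    refine hb.trans ?_
    have h2 : C * |a| * (ε / (C * |a| + 1)) ≤ ε := by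
      rw [mul_div_assoc', div_le_iff₀ (by positivity)]
      nlinarith [abs_nonneg a]
    nlinarith [abs_nonneg τ]
  have hL : ∀ (L : F →L[ℝ] F) {f : ℝ → F}, f =o[𝓝 0] (fun τ : ℝ ↦ τ) →
      (fun τ ↦ L (f τ)) =o[𝓝 0] fun τ : ℝ ↦ τ := fun L f hf ↦
    (L.isBigO_comp f _).trans_isLittleO hf
  refine (hL (fr.g (x + a • stdVec i)) (hu.add (hL (fr.h x) hstart))).congr_left fun τ ↦ ?_
  rw [sub_add_cancel, fr.g_h_apply hxa]

end Propagation

/-! ### Sections over an open subset of `ℝⁿ` in coordinates -/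

section CoordinateRepresentation

open Filter Topology

theorem mvfderiv_comp_val {n : ℕ} {B : Opens (EuclideanSpace ℝ (Fin n))}
    {F : Type*} [NormedAddCommGroup F] [NormedSpace ℝ F]
    {f : EuclideanSpace ℝ (Fin n) → F} {x : B} (hf : DifferentiableAt ℝ f x) :
    mvfderiv (𝓡 n) (fun y : B ↦ f y) x = fderiv ℝ f (x : EuclideanSpace ℝ (Fin n)) := by
  have hfm : MDifferentiableAt (𝓡 n) 𝓘(ℝ, F) (fun y : B ↦ f y) x := by
    have h2 : MDifferentiableAt (𝓡 n) (𝓡 n) (Subtype.val : B → EuclideanSpace ℝ (Fin n)) x :=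
      ((contMDiff_subtype_val (n := 1)) x).mdifferentiableAt (by norm_num)
    exact MDifferentiableAt.comp (f := Subtype.val) x hf.mdifferentiableAt h2
  rw [hfm.mvfderiv]
  have : (writtenInExtChartAt (𝓡 n) 𝓘(ℝ, F) x fun y : B ↦ f y)
      =ᶠ[𝓝 (x : EuclideanSpace ℝ (Fin n))] f := by
    have := Opens.chartAt_subtype_val_symm_eventuallyEq (H := EuclideanSpace ℝ (Fin n)) B (x := x)
    simp only [chartAt_self_eq, OpenPartialHomeomorph.refl_symm,
      OpenPartialHomeomorph.refl_apply] at this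
    filter_upwards [this] with y hy
    simp [writtenInExtChartAt] at hy ⊢
    rw [← hy]
    rfl
  rw [← this.fderiv_eq]
  simp
  rfl

/-- All charts of `B` come from the inclusion into `ℝⁿ`, so transition maps are locally the
identity. Evaluating a one-form on these fields yields its components with no loss of regularity. -/
theorem contMDiff_const_vectorField {n : ℕ} {B : Opens (EuclideanSpace ℝ (Fin n))} (m : ℕ∞)
    (w : EuclideanSpace ℝ (Fin n)) :
    ContMDiff (𝓡 n) ((𝓡 n).prod (𝓡 n)) m
      (fun x : B ↦ TotalSpace.mk' (EuclideanSpace ℝ (Fin n))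
        (E := (TangentSpace (𝓡 n) : B → Type _)) x w) := by
  intro x₀
  refine (contMDiffAt_section (IB := 𝓡 n) (F := EuclideanSpace ℝ (Fin n))
    (E := (TangentSpace (𝓡 n) : B → Type _)) (s := fun _ ↦ w) x₀).2 ?_
  refine (contMDiffAt_const (c := w)).congr_of_eventuallyEq (.of_forall fun x ↦ ?_)
  -- The trivialization of the tangent bundle at `x₀` acts by the derivative of the transition map.
  change fderivWithin ℝ ((chartAt (EuclideanSpace ℝ (Fin n)) x₀).extend (𝓡 n) ∘
    ((chartAt (EuclideanSpace ℝ (Fin n)) x).extend (𝓡 n)).symm) (Set.range (𝓡 n))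
    ((chartAt (EuclideanSpace ℝ (Fin n)) x).extend (𝓡 n) x) w = w
  have h := Opens.chartAt_subtype_val_symm_eventuallyEq (H := EuclideanSpace ℝ (Fin n)) B (x := x)
  simp only [chartAt_self_eq, OpenPartialHomeomorph.refl_symm,
      OpenPartialHomeomorph.refl_apply] at h
  have h2 : ((chartAt (EuclideanSpace ℝ (Fin n)) x₀).extend (𝓡 n) ∘
      ((chartAt (EuclideanSpace ℝ (Fin n)) x).extend (𝓡 n)).symm)
      =ᶠ[𝓝 (x : EuclideanSpace ℝ (Fin n))] id := by
    filter_upwards [h] with y hy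
    exact hy.symm
  have h3 : ((chartAt (EuclideanSpace ℝ (Fin n)) x).extend (𝓡 n)) x
      = (x : EuclideanSpace ℝ (Fin n)) := rfl
  rw [h3]
  simp only [modelWithCornersSelf_coe, Set.range_id, fderivWithin_univ]
  rw [h2.fderiv_eq]
  simp

variable {n : ℕ} {B : Opens (EuclideanSpace ℝ (Fin n))}
  {F : Type*} [NormedAddCommGroup F]
  {V : B → Type*} [TopologicalSpace (TotalSpace F V)]

open Classical in
/-- The representation of a section `s` in the trivialization `e`, as a function on `ℝⁿ`. -/
noncomputable def coordRep (e : Trivialization F (π F V)) (s : Π x : B, V x)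
    (x : EuclideanSpace ℝ (Fin n)) : F :=
  if h : x ∈ B then (e ⟨⟨x, h⟩, s ⟨x, h⟩⟩).2 else 0

theorem coordRep_coe (e : Trivialization F (π F V)) (s : Π x : B, V x) (x : B) :
    coordRep e s x = (e ⟨x, s x⟩).2 := by
  simp [coordRep]

theorem continuousAt_section_iff_coordRep (e : Trivialization F (π F V))
    {s : Π x : B, V x} {x : B} (hx : x ∈ e.baseSet) :
    ContinuousAt (fun y ↦ TotalSpace.mk' F y (s y)) x ↔
      ContinuousAt (coordRep e s) (x : EuclideanSpace ℝ (Fin n)) := by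
  have h1 : ContinuousAt (fun y ↦ TotalSpace.mk' F y (s y)) x ↔
      ContinuousAt (fun y ↦ (e ⟨y, s y⟩).2) x := by
    rw [ContinuousAt, e.tendsto_nhds_iff (by simpa [e.mem_source] using hx)]
    simp [ContinuousAt, Function.comp_def]
    exact fun _ ↦ continuousAt_id
  rw [h1, ← B.isOpenEmbedding'.continuousAt_iff]
  simp [Function.comp_def, coordRep_coe]

variable [NormedSpace ℝ F] [∀ x, TopologicalSpace (V x)] [FiberBundle F V]
  [∀ x, AddCommGroup (V x)] [∀ x, Module ℝ (V x)] [VectorBundle ℝ F V]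

theorem contMDiffAt_section_iff_coordRep {l m : ℕ∞} (hm : m ≤ l)
    [ContMDiffVectorBundle l F V (𝓡 n)]
    (e : Trivialization F (π F V)) [MemTrivializationAtlas e] {s : Π x : B, V x} {x : B}
    (hx : x ∈ e.baseSet) :
    ContMDiffAt (𝓡 n) ((𝓡 n).prod 𝓘(ℝ, F)) m (fun y ↦ TotalSpace.mk' F y (s y)) x ↔
      ContDiffAt ℝ m (coordRep e s) (x : EuclideanSpace ℝ (Fin n)) := by
  have : ContMDiffVectorBundle m F V (𝓡 n) :=
    .of_le (n := l) (by exact_mod_cast hm)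
  rw [e.contMDiffAt_section_iff hx, ← contMDiffAt_iff_contDiffAt, ← contMDiffAt_subtype_iff]
  simp only [coordRep_coe]

end CoordinateRepresentation

/-! ### Connections as `d + Γ`; parallelism as a differential equation -/

section ConnectionForm

open Filter Topology

variable {n : ℕ} {B : Opens (EuclideanSpace ℝ (Fin n))}
  {F : Type*} [NormedAddCommGroup F] [NormedSpace ℝ F]
  {V : B → Type*} [TopologicalSpace (TotalSpace F V)]
  [∀ x, AddCommGroup (V x)] [∀ x, Module ℝ (V x)] [∀ x, TopologicalSpace (V x)]
  [∀ x, IsTopologicalAddGroup (V x)] [∀ x, ContinuousSMul ℝ (V x)]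
  [FiberBundle F V] [VectorBundle ℝ F V]

namespace Connection

theorem toFun_sum [ContMDiffVectorBundle 1 F V (𝓡 n)] (D : Connection n F V) (U : Opens B)
    {ι : Type*} (S : Finset ι)
    (s : ι → Π x : B, V x) (hs : ∀ i, IsSectionOn n F 1 (U : Set B) (s i)) :
    IsSectionOn n F 1 (U : Set B) (∑ i ∈ S, s i) ∧
      ∀ x ∈ U, D.toFun U (∑ i ∈ S, s i) x = ∑ i ∈ S, D.toFun U (s i) x := by
  classical
  have h0 : IsSectionOn n F 1 (U : Set B) (0 : Π x : B, V x) := by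
    exact_mod_cast (contMDiff_zeroSection ℝ V).contMDiffOn
  induction S using Finset.induction_on with
  | empty =>
    refine ⟨by simpa using h0, fun x hx ↦ ?_⟩
    -- Additivity at `0 + 0` forces `∇ 0 = 0`.
    have h1 := D.add' U 0 0 h0 h0 x hx
    simpa using h1
  | insert i S hi ih =>
    simp only [Finset.sum_insert hi]
    refine ⟨?_, fun x hx ↦ ?_⟩
    · exact ContMDiffOn.add_section (hs i) ih.1
    · rw [D.add' U _ _ (hs i) ih.1 x hx, ih.2 x hx]

/-- `Γ` is of class `C^m`, and the connection has the form `d + Γ` in the local trivialization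
`e`. -/
structure IsConnectionForm (D : Connection n F V) (e : Trivialization F (π F V))
    [MemTrivializationAtlas e] (m : ℕ∞)
    (Γ : EuclideanSpace ℝ (Fin n) → EuclideanSpace ℝ (Fin n) →L[ℝ] F →L[ℝ] F) : Prop where
  contDiffOn : ContDiffOn ℝ m Γ (Subtype.val '' e.baseSet)
  toFun_apply : ∀ (U : Opens B) (s : Π x : B, V x), IsSectionOn n F 1 (U : Set B) s →
    ∀ x ∈ U, x ∈ e.baseSet → ∀ w : EuclideanSpace ℝ (Fin n),
      (e ⟨x, D.toFun U s x w⟩).2 = fderiv ℝ (coordRep e s) x w + Γ x w (coordRep e s x)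

/-- Expanding a section in a local frame `σ`, the Leibniz rule leaves only the derivatives of the
coefficients and the sections `∇ σⱼ`, whose components are the entries of `Γ`. These are `C^m` since
the frame is `C^l`. -/
theorem exists_connectionForm [FiniteDimensional ℝ F] {l m : ℕ∞} (hl : 1 ≤ l)
    [ContMDiffVectorBundle l F V (𝓡 n)]
    (D : Connection n F V) (hD : D.IsOfClass l m) (e : Trivialization F (π F V))
    [MemTrivializationAtlas e] :
    ∃ Γ, D.IsConnectionForm e m Γ := by
  have hl1 : ContMDiffVectorBundle 1 F V (𝓡 n) := .of_le (n := l) (by exact_mod_cast hl)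
  have hml : m ≤ l := le_self_add.trans hD.1
  have hm1 : ContMDiffVectorBundle m F V (𝓡 n) := .of_le (n := l) (by exact_mod_cast hml)
  let b := Module.finBasis ℝ F
  let W : Opens B := ⟨e.baseSet, e.open_baseSet⟩
  let σ := e.localFrame b
  have hσl : ∀ j, IsSectionOn n F l (W : Set B) (σ j) := fun j ↦
    e.contMDiffOn_localFrame_baseSet (l : ℕ∞ω) b j
  have hσ1 : ∀ j, IsSectionOn n F 1 (W : Set B) (σ j) := fun j ↦
    e.contMDiffOn_localFrame_baseSet (1 : ℕ∞ω) b j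
  have hσx : ∀ j (x : B), x ∈ e.baseSet → (e ⟨x, σ j x⟩).2 = b j := fun j x hx ↦ by
    simp [σ, hx, Trivialization.basisAt]
  let c : Fin (Module.finrank ℝ F) → Fin n → EuclideanSpace ℝ (Fin n) → F := fun j k ↦
    coordRep e fun x ↦ D.toFun W (σ j) x (stdVec k : EuclideanSpace ℝ (Fin n))
  have hc : ∀ j k, ContDiffOn ℝ m (c j k) (Subtype.val '' e.baseSet) := by
    rintro j k _ ⟨x, hx, rfl⟩
    refine ContDiffAt.contDiffWithinAt ?_
    rw [← contMDiffAt_section_iff_coordRep hml e hx]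
    refine ContMDiffAt.clm_bundle_apply (b := fun x : B ↦ x)
      (E₁ := (TangentSpace (𝓡 n) : B → Type _)) (F₁ := EuclideanSpace ℝ (Fin n))
      (ϕ := fun x ↦ D.toFun W (σ j) x)
      (v := fun x ↦ (stdVec k : EuclideanSpace ℝ (Fin n))) ?_ ?_
    · exact ContMDiffOn.contMDiffAt (hD.2 W (σ j) (hσl j)) (W.isOpen.mem_nhds hx)
    · exact contMDiff_const_vectorField m _ x
  let Γ : EuclideanSpace ℝ (Fin n) → EuclideanSpace ℝ (Fin n) →L[ℝ] F →L[ℝ] F := fun x ↦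
    ∑ k, (EuclideanSpace.proj k : EuclideanSpace ℝ (Fin n) →L[ℝ] ℝ).smulRight
      (∑ j, (LinearMap.toContinuousLinearMap (b.coord j)).smulRight (c j k x))
  refine ⟨Γ, ?_, fun U s hs x hxU hxe w ↦ ?_⟩
  · refine ContDiffOn.sum fun k _ ↦ ?_
    refine contDiffOn_const.smulRight (ContDiffOn.sum fun j _ ↦ ?_)
    exact contDiffOn_const.smulRight (hc j k)
  · let f : Fin (Module.finrank ℝ F) → B → ℝ := fun j y ↦ b.coord j (coordRep e s y)
    let U' : Opens B := U ⊓ W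
    have hxU' : x ∈ U' := ⟨hxU, hxe⟩
    have hrep : ∀ y ∈ U', ContDiffAt ℝ 1 (coordRep e s) (y : EuclideanSpace ℝ (Fin n)) :=
      fun y hy ↦ (contMDiffAt_section_iff_coordRep hl e hy.2).1
        (ContMDiffOn.contMDiffAt hs (U.isOpen.mem_nhds hy.1))
    have hf : ∀ j, ContMDiffOn (𝓡 n) 𝓘(ℝ, ℝ) 1 (f j) (U' : Set B) := fun j y hy ↦ by
      have h1 : ContDiffAt ℝ 1 (fun z ↦ b.coord j (coordRep e s z))
          (y : EuclideanSpace ℝ (Fin n)) :=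
        (LinearMap.toContinuousLinearMap (b.coord j)).contDiff.contDiffAt.comp _ (hrep y hy)
      exact (contMDiffAt_subtype_iff.2 h1.contMDiffAt).contMDiffWithinAt
    have hσU' : ∀ j, IsSectionOn n F 1 (U' : Set B) (σ j) := fun j ↦
      ContMDiffOn.mono (hσ1 j) fun y hy ↦ hy.2
    have hfσ : ∀ j, IsSectionOn n F 1 (U' : Set B) (fun y ↦ f j y • σ j y) := fun j ↦
      ContMDiffOn.smul_section (hf j) (hσU' j)
    have hsum := D.toFun_sum U' Finset.univ (fun j y ↦ f j y • σ j y) hfσ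
    have heq : ∀ y ∈ U', (∑ j, fun y ↦ f j y • σ j y) y = s y := by
      intro y hy
      apply (e.continuousLinearEquivAt ℝ y hy.2).injective
      have h1 : ∀ j, e.continuousLinearEquivAt ℝ y hy.2 (σ j y) = b j := fun j ↦ hσx j y hy.2
      rw [Finset.sum_apply, map_sum]
      simp only [map_smul, h1, f]
      rw [coordRep_coe]
      exact b.sum_repr (e ⟨y, s y⟩).2
    have h2 : D.toFun U s x = ∑ j, D.toFun U' (fun y ↦ f j y • σ j y) x := by
      rw [← hsum.2 x hxU']
      exact (D.restrict' U' U s _ inf_le_left hs heq x hxU').symm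
    have h3 : ∀ j, D.toFun U' (fun y ↦ f j y • σ j y) x =
        (mvfderiv (𝓡 n) (f j) x).smulRight (σ j x) + f j x • D.toFun W (σ j) x := fun j ↦ by
      rw [D.leibniz' U' (f j) (σ j) (hf j) (hσU' j) x hxU',
        D.restrict' U' W (σ j) (σ j) inf_le_right (hσ1 j) (fun _ _ ↦ rfl) x hxU']
    have hdiff : DifferentiableAt ℝ (coordRep e s) (x : EuclideanSpace ℝ (Fin n)) :=
      (hrep x hxU').differentiableAt (by norm_num)
    have h4 : ∀ j, mvfderiv (𝓡 n) (f j) x w = b.coord j (fderiv ℝ (coordRep e s) x w) := by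
      intro j
      have h5 : HasFDerivAt (fun z ↦ b.coord j (coordRep e s z))
          ((LinearMap.toContinuousLinearMap (b.coord j)).comp (fderiv ℝ (coordRep e s) x))
          (x : EuclideanSpace ℝ (Fin n)) :=
        (LinearMap.toContinuousLinearMap (b.coord j)).hasFDerivAt.comp _ hdiff.hasFDerivAt
      have h6 := mvfderiv_comp_val h5.differentiableAt
      rw [h5.fderiv] at h6
      exact DFunLike.congr_fun h6 w
    have hw : (w : EuclideanSpace ℝ (Fin n)) = ∑ k, w k • stdVec k := by
      ext i; simp [Finset.sum_apply, Pi.single_apply]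
    let L := e.continuousLinearEquivAt ℝ x hxe
    have hL : ∀ v : V x, (e ⟨x, v⟩).2 = L v := fun v ↦ rfl
    have h7 : ∀ j, L (D.toFun W (σ j) x w) = ∑ k, w k • c j k x := by
      intro j
      have : D.toFun W (σ j) x w =
          ∑ k, w k • D.toFun W (σ j) x (stdVec k : EuclideanSpace ℝ (Fin n)) := by
        conv_lhs => rw [hw]
        exact (map_sum _ _ _).trans (Finset.sum_congr rfl fun k _ ↦ map_smul _ _ _)
      rw [this, map_sum]
      refine Finset.sum_congr rfl fun k _ ↦ ?_
      rw [map_smul]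
      simp only [c, coordRep_coe]
      rfl
    have h8 : D.toFun U s x w = ∑ j, (b.coord j (fderiv ℝ (coordRep e s) x w) • σ j x
        + f j x • D.toFun W (σ j) x w) := by
      rw [h2]
      refine (sum_apply _ _ _).trans (Finset.sum_congr rfl fun j _ ↦ ?_)
      rw [h3, ← h4]
      rfl
    have h1 : ∀ j, L (σ j x) = b j := fun j ↦ hσx j x hxe
    rw [hL, h8, map_sum]
    simp only [map_add, map_smul, h1, h7, Finset.sum_add_distrib]
    congr 1
    · exact b.sum_repr _
    · simp only [Γ, f, sum_apply, ContinuousLinearMap.smulRight_apply,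
        Finset.smul_sum]
      rw [Finset.sum_comm]
      refine Finset.sum_congr rfl fun k _ ↦ ?_
      simp only [smul_apply, ContinuousLinearMap.smulRight_apply]
      exact Finset.sum_congr rfl fun j _ ↦ smul_comm _ _ _

theorem IsParallelOn.continuousAt {D : Connection n F V} {U : Opens B} {s : Π x : B, V x}
    (hs : D.IsParallelOn U s) {x : B} (hx : x ∈ U) :
    ContinuousAt (fun y ↦ TotalSpace.mk' F y (s y)) x :=
  (ContMDiffOn.contMDiffAt hs.1 (U.isOpen.mem_nhds hx)).continuousAt

theorem IsParallelOn.mono {D : Connection n F V} {U W : Opens B} {s : Π x : B, V x}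
    (hs : D.IsParallelOn U s) (hW : W ≤ U) : D.IsParallelOn W s :=
  ⟨ContMDiffOn.mono hs.1 hW, fun x hx ↦ by
    rw [D.restrict' W U s s hW hs.1 (fun _ _ ↦ rfl) x hx]; exact hs.2 x (hW hx)⟩

theorem IsParallelOn.congr {D : Connection n F V} {U : Opens B} {s t : Π x : B, V x}
    (hs : D.IsParallelOn U s) (hst : ∀ x ∈ U, t x = s x) : D.IsParallelOn U t :=
  ⟨ContMDiffOn.congr hs.1 fun x hx ↦ by rw [hst x hx], fun x hx ↦ by
    rw [D.restrict' U U s t le_rfl hs.1 hst x hx]; exact hs.2 x hx⟩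

theorem isParallelOn_of_forall_exists {D : Connection n F V} {U : Opens B} {s : Π x : B, V x}
    (h : ∀ x ∈ U, ∃ W : Opens B, x ∈ W ∧ D.IsParallelOn W s) : D.IsParallelOn U s := by
  have hs : IsSectionOn n F 1 (U : Set B) s := fun x hx ↦ by
    obtain ⟨W, hxW, hW⟩ := h x hx
    exact (ContMDiffOn.contMDiffAt hW.1 (W.isOpen.mem_nhds hxW)).contMDiffWithinAt
  refine ⟨hs, fun x hx ↦ ?_⟩
  obtain ⟨W, hxW, hW⟩ := h x hx
  rw [← D.restrict' (U ⊓ W) U s s inf_le_left hs (fun _ _ ↦ rfl) x ⟨hx, hxW⟩]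
  exact (hW.mono inf_le_right).2 x ⟨hx, hxW⟩

/-- No `C¹` condition appears on the right: a differentiable solution is continuous, so `dt = -Γ t`
is continuous too. -/
theorem IsConnectionForm.isParallelOn_iff {l m : ℕ∞} (hl : 1 ≤ l)
    [ContMDiffVectorBundle l F V (𝓡 n)] {D : Connection n F V} {e : Trivialization F (π F V)}
    [MemTrivializationAtlas e]
    {Γ : EuclideanSpace ℝ (Fin n) → EuclideanSpace ℝ (Fin n) →L[ℝ] F →L[ℝ] F}
    (hΓ : D.IsConnectionForm e m Γ) {U : Opens B} (hU : (U : Set B) ⊆ e.baseSet)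
    {s : Π x : B, V x} :
    D.IsParallelOn U s ↔ ∀ x ∈ U, HasFDerivAt (coordRep e s)
      (-(Γ x).flip (coordRep e s x)) (x : EuclideanSpace ℝ (Fin n)) := by
  have hopen : IsOpen (Subtype.val '' (U : Set B)) := B.isOpenEmbedding'.isOpenMap _ U.isOpen
  constructor
  · intro hs x hx
    have h1 := (contMDiffAt_section_iff_coordRep hl e (hU hx)).1
      (ContMDiffOn.contMDiffAt hs.1 (U.isOpen.mem_nhds hx))
    refine (h1.differentiableAt (by norm_num)).hasFDerivAt.congr_fderiv
      (ContinuousLinearMap.ext fun w ↦ ?_)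
    have h2 := hΓ.toFun_apply U s hs.1 x hx (hU hx) w
    rw [hs.2 x hx] at h2
    have h3 : (e ⟨x, (0 : TangentSpace (𝓡 n) x →L[ℝ] V x) w⟩).2 = 0 :=
      (e.continuousLinearEquivAt ℝ x (hU hx)).map_zero
    rw [h3] at h2
    simpa using eq_neg_of_add_eq_zero_left h2.symm
  · intro hs
    have hc : ContinuousOn (coordRep e s) (Subtype.val '' (U : Set B)) := by
      rintro _ ⟨x, hx, rfl⟩
      exact (hs x hx).continuousAt.continuousWithinAt
    have hΓc : ContinuousOn Γ (Subtype.val '' (U : Set B)) :=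
      hΓ.contDiffOn.continuousOn.mono (Set.image_mono hU)
    have hC1 : ContDiffOn ℝ 1 (coordRep e s) (Subtype.val '' (U : Set B)) := by
      rw [← zero_add (1 : ℕ∞ω), contDiffOn_succ_iff_fderiv_of_isOpen hopen, contDiffOn_zero]
      refine ⟨?_, by simp, ?_⟩
      · rintro _ ⟨x, hx, rfl⟩
        exact (hs x hx).differentiableAt.differentiableWithinAt
      · have h1 : ContinuousOn (fun y ↦ -(Γ y).flip (coordRep e s y))
            (Subtype.val '' (U : Set B)) :=
          (((ContinuousLinearMap.flipₗᵢ ℝ (EuclideanSpace ℝ (Fin n)) F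
            F).continuous.comp_continuousOn hΓc).clm_apply hc).neg
        refine h1.congr ?_
        rintro _ ⟨x, hx, rfl⟩
        exact (hs x hx).fderiv
    have hsec : IsSectionOn n F 1 (U : Set B) s := fun x hx ↦
      ((contMDiffAt_section_iff_coordRep hl e (hU hx)).2
        (hC1.contDiffAt (hopen.mem_nhds ⟨x, hx, rfl⟩))).contMDiffWithinAt
    refine ⟨hsec, fun x hx ↦ ?_⟩
    ext w
    apply (e.continuousLinearEquivAt ℝ x (hU hx)).injective
    refine (hΓ.toFun_apply U s hsec x hx (hU hx) w).trans ?_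
    rw [(hs x hx).fderiv]
    exact (neg_add_cancel _).trans (e.continuousLinearEquivAt ℝ x (hU hx)).map_zero.symm

/-- A continuous section that is parallel in all coordinate directions is parallel. -/
theorem IsConnectionForm.isParallelOn_of_lineParallelAt {l m : ℕ∞} (hl : 1 ≤ l)
    [ContMDiffVectorBundle l F V (𝓡 n)] {D : Connection n F V} {e : Trivialization F (π F V)}
    [MemTrivializationAtlas e]
    {Γ : EuclideanSpace ℝ (Fin n) → EuclideanSpace ℝ (Fin n) →L[ℝ] F →L[ℝ] F}
    (hΓ : D.IsConnectionForm e m Γ) {U : Opens B} (hU : (U : Set B) ⊆ e.baseSet)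
    {s : Π x : B, V x} (hs : Continuous fun y ↦ TotalSpace.mk' F y (s y))
    (h : ∀ x ∈ U, ∀ i, LineParallelAt i (fun y ↦ Γ y (stdVec i)) (coordRep e s) x) :
    D.IsParallelOn U s := by
  rw [hΓ.isParallelOn_iff hl hU]
  intro x hx
  refine hasFDerivAt_of_lineParallelAt (B.isOpenEmbedding'.isOpenMap _ U.isOpen)
    (hΓ.contDiffOn.continuousOn.mono (Set.image_mono hU)) ?_ ?_ ⟨x, hx, rfl⟩
  · rintro _ ⟨y, hy, rfl⟩
    exact ((continuousAt_section_iff_coordRep e (hU hy)).1 hs.continuousAt).continuousWithinAt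
  · rintro _ ⟨y, hy, rfl⟩ i
    exact h y hy i

end Connection

end ConnectionForm

/-! ### Continuous extension across the closed set -/

section Extension

open Set Filter Topology Metric

variable {n : ℕ} {J : Fin n → Opens ℝ}

theorem setCoord_setCoord (i : Fin n) (x : EuclideanSpace ℝ (Fin n)) (ξ ζ : ℝ) :
    setCoord i (setCoord i x ξ) ζ = setCoord i x ζ := by
  ext k
  by_cases h : k = i
  · subst h; simp [setCoord_apply_same]
  · simp [setCoord_apply_of_ne h]

theorem setCoord_mem_openBox {i : Fin n} {x : EuclideanSpace ℝ (Fin n)} {ξ : ℝ}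
    (hx : x ∈ openBox J) (hξ : ξ ∈ J i) : setCoord i x ξ ∈ openBox J := by
  intro k
  by_cases h : k = i
  · subst h; rwa [setCoord_apply_same]
  · rw [setCoord_apply_of_ne h]; exact hx k

/-- An open property of points of a box that holds for small `i`-th coordinate and propagates
locally along the `i`-th direction holds everywhere. -/
theorem openBox_induction {P : openBox J → Prop} (hP : IsOpen {x | P x}) {i : Fin n}
    (hJ : (J i : Set ℝ).OrdConnected) {b : ℝ} (hb : b ∈ J i) (h0 : ∀ x, x.1 i < b → P x)
    (hstep : ∀ q : openBox J, ∀ᶠ c in 𝓝 (q.1 i), ∀ h : setCoord i q.1 c ∈ openBox J,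
      P ⟨setCoord i q.1 c, h⟩ → P q) (x : openBox J) : P x := by
  set S : Set ℝ := {c | ∃ h : setCoord i x.1 c ∈ openBox J, P ⟨setCoord i x.1 c, h⟩} with hS
  have hcont : Continuous fun c ↦ setCoord i x.1 c :=
    (continuous_setCoord i).comp (by fun_prop : Continuous fun c : ℝ ↦ (x.1, c))
  have hSo : IsOpen S := by
    have h1 : IsOpen (Subtype.val '' {x | P x}) := (openBox J).isOpenEmbedding'.isOpenMap _ hP
    convert h1.preimage hcont using 1
    ext c
    constructor
    · rintro ⟨h, hc⟩; exact ⟨_, hc, rfl⟩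
    · rintro ⟨y, hy, hyc⟩
      replace hyc : y.1 = setCoord i x.1 c := hyc
      have hmem : setCoord i x.1 c ∈ openBox J := by rw [← hyc]; exact y.2
      refine ⟨hmem, ?_⟩
      have : y = ⟨setCoord i x.1 c, hmem⟩ := Subtype.ext hyc
      rwa [← this]
  -- Connectedness of the interval: `S` is open, contains points of `J i` just below `b`, and
  -- `hstep` makes it closed relative to `J i`.
  have hsub : (J i : Set ℝ) ⊆ S := by
    refine hJ.isPreconnected.subset_of_closure_inter_subset hSo ?_ ?_
    · obtain ⟨ε, hε, hball⟩ := Metric.isOpen_iff.1 (J i).isOpen b hb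
      have hc : b - ε / 2 ∈ (J i : Set ℝ) := hball (by
        rw [mem_ball, Real.dist_eq, abs_lt]; constructor <;> linarith)
      refine ⟨b - ε / 2, hc, setCoord_mem_openBox x.2 hc, h0 _ ?_⟩
      simp only [setCoord_apply_same]
      linarith
    · rintro c ⟨hcS, hcJ⟩
      have hq := hstep ⟨setCoord i x.1 c, setCoord_mem_openBox x.2 hcJ⟩
      simp only [setCoord_apply_same, setCoord_setCoord] at hq
      obtain ⟨c', ⟨h', hP'⟩, hc'⟩ := ((mem_closure_iff_frequently.1 hcS).and_eventually hq).exists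
      exact ⟨_, hc' h' hP'⟩
  obtain ⟨h, hx⟩ := hsub (x.2 i)
  simpa only [setCoord_self] using hx

theorem mem_closure_setOf_apply_notMem {j : Fin n} {C : Set ℝ}
    (hC : ∀ c ∈ J j, c ∈ closure Cᶜ) {x : EuclideanSpace ℝ (Fin n)} (hx : x ∈ openBox J) :
    x ∈ closure {y : EuclideanSpace ℝ (Fin n) | y j ∉ C} := by
  have hcont : Continuous fun c ↦ setCoord j x c :=
    (continuous_setCoord j).comp (by fun_prop : Continuous fun c : ℝ ↦ (x, c))
  have h1 := map_mem_closure hcont (hC _ (hx j))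
    (t := {y : EuclideanSpace ℝ (Fin n) | y j ∉ C}) fun c hc ↦ by
      simpa [setCoord_apply_same] using hc
  simpa only [setCoord_self] using h1

theorem frequently_apply_notMem {j : Fin n} {C : Set ℝ}
    (hC : ∀ c ∈ J j, c ∈ closure Cᶜ) (x : openBox J) : ∃ᶠ y in 𝓝 x, y.1 j ∉ C := by
  have h1 := mem_closure_iff_frequently.1 (mem_closure_setOf_apply_notMem hC x.2)
  rw [← (openBox J).isOpenEmbedding'.map_nhds_eq, frequently_map] at h1
  exact h1

variable {F : Type*} [NormedAddCommGroup F] [NormedSpace ℝ F]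
  {V : openBox J → Type*} [TopologicalSpace (TotalSpace F V)]
  [∀ x, AddCommGroup (V x)] [∀ x, Module ℝ (V x)] [∀ x, TopologicalSpace (V x)]
  [∀ x, IsTopologicalAddGroup (V x)] [∀ x, ContinuousSMul ℝ (V x)]
  [FiberBundle F V] [VectorBundle ℝ F V]

omit [∀ x, IsTopologicalAddGroup (V x)] [∀ x, ContinuousSMul ℝ (V x)] in
-- Uniqueness of continuous extensions from a dense set; it is what glues the local extensions.
theorem section_eq_of_frequently_eq {s t : Π x : openBox J, V x} {x : openBox J}
    (hs : ContinuousAt (fun y ↦ TotalSpace.mk' F y (s y)) x)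
    (ht : ContinuousAt (fun y ↦ TotalSpace.mk' F y (t y)) x) (h : ∃ᶠ y in 𝓝 x, s y = t y) :
    s x = t x := by
  have hx := FiberBundle.mem_baseSet_trivializationAt' (F := F) (E := V) x
  rw [FiberBundle.continuousAt_section] at hs ht
  apply ((trivializationAt F V x).continuousLinearEquivAt ℝ x hx).injective
  have h1 : ∃ᶠ y in 𝓝 x, (trivializationAt F V x ⟨y, s y⟩).2 -
      (trivializationAt F V x ⟨y, t y⟩).2 ∈ ({0} : Set F) :=
    h.mono fun y hy ↦ by simp [hy]
  exact sub_eq_zero.1 (isClosed_singleton.mem_of_frequently_of_tendsto h1 (hs.sub ht))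

namespace Connection

/-- Continuous extension of a parallel section by parallel transport along the `i`-th direction. -/
theorem exists_continuous_extension [FiniteDimensional ℝ F] {l m : ℕ∞} (hl : 1 ≤ l)
    [ContMDiffVectorBundle l F V (𝓡 n)] {D : Connection n F V} (hD : D.IsOfClass l m)
    {A : Closeds (openBox J)} {i j : Fin n} (hij : j ≠ i) (hJ : (J i : Set ℝ).OrdConnected)
    {C : Set ℝ} (hC : ∀ c ∈ J j, c ∈ closure Cᶜ) {b : ℝ} (hb : b ∈ J i)
    (hA : ∀ x ∈ A, b ≤ x.1 i ∧ x.1 j ∈ C) {s : Π x, V x} (hs : D.IsParallelOn A.compl s) :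
    ∃ t : Π x, V x, Continuous (fun x ↦ TotalSpace.mk' F x (t x)) ∧ ∀ x ∉ A, t x = s x := by
  have hsc : ∀ x ∉ A, ContinuousAt (fun y ↦ TotalSpace.mk' F y (s y)) x := fun x hx ↦
    hs.continuousAt hx
  -- The property to be propagated along direction `i`: a continuous section near `x` that agrees
  -- with `s` off `C`. Agreement there already determines it.
  have hlocal : ∀ x : openBox J, ∃ t : Π x, V x, ∀ᶠ y in 𝓝 x,
      ContinuousAt (fun z ↦ TotalSpace.mk' F z (t z)) y ∧ (y.1 j ∉ C → t y = s y) := by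
    refine openBox_induction ?_ hJ hb ?_ ?_
    · refine isOpen_iff_eventually.2 fun x ⟨t, ht⟩ ↦ ?_
      exact ht.eventually_nhds.mono fun y hy ↦ ⟨t, hy⟩
    · intro x hx
      refine ⟨s, ?_⟩
      have hxA : x ∉ A := fun h ↦ absurd (hA x h).1 (not_le.2 hx)
      filter_upwards [A.compl.isOpen.mem_nhds hxA] with y hy
      exact ⟨hsc y hy, fun _ ↦ rfl⟩
    · intro q
      set e := trivializationAt F V q
      have hqe : q ∈ e.baseSet := FiberBundle.mem_baseSet_trivializationAt' q
      obtain ⟨Γ, hΓ⟩ := D.exists_connectionForm hl hD e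
      have hΩ : IsOpen (Subtype.val '' e.baseSet) :=
        (openBox J).isOpenEmbedding'.isOpenMap _ e.open_baseSet
      obtain ⟨r, hr, hball, ⟨fr⟩⟩ := exists_lineFrame (A := fun y ↦ Γ y (stdVec i)) i hΩ
        (hΓ.contDiffOn.continuousOn.clm_apply continuousOn_const) ⟨q, hqe, rfl⟩
      have hcontc : Continuous fun c ↦ setCoord i q.1 c :=
        (continuous_setCoord i).comp (by fun_prop : Continuous fun c : ℝ ↦ (q.1, c))
      have hev : ∀ᶠ c in 𝓝 (q.1 i), setCoord i q.1 c ∈ ball q.1 r :=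
        hcontc.continuousAt.eventually_mem (isOpen_ball.mem_nhds (by
          rw [setCoord_self]; exact mem_ball_self hr))
      filter_upwards [hev] with c hc h
      rintro ⟨t, ht⟩
      have hcJ : c ∈ J i := by have := h i; rwa [setCoord_apply_same] at this
      let κ : openBox J → openBox J := fun y ↦ ⟨setCoord i y.1 c, setCoord_mem_openBox y.2 hcJ⟩
      have hκ : Continuous κ := ((continuous_setCoord i).comp
        (by fun_prop : Continuous fun y : openBox J ↦ (y.1, c))).subtype_mk _
      -- `g` at `y` after `h` at `κ y` is parallel transport along direction `i` from the slice `x i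
      -- = c`, where `t` is known.
      let t' : Π x, V x := fun y ↦ e.symm y (fr.g y.1 (fr.h (κ y).1 (coordRep e t (κ y).1)))
      have hbase : ∀ y : openBox J, y.1 ∈ ball q.1 r → y ∈ e.baseSet := fun y hy ↦ by
        obtain ⟨y', hy', hyy'⟩ := hball hy
        rwa [← Subtype.ext hyy']
      have ht'e : ∀ y : openBox J, y ∈ e.baseSet → (e ⟨y, t' y⟩).2 =
          fr.g y.1 (fr.h (κ y).1 (coordRep e t (κ y).1)) := fun y hy ↦ by
        rw [e.apply_mk_symm hy]
      have hq : ∀ᶠ y in 𝓝 q, y.1 ∈ ball q.1 r :=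
        continuous_subtype_val.continuousAt.eventually_mem
          (isOpen_ball.mem_nhds (mem_ball_self hr))
      have hκq : ∀ᶠ y in 𝓝 q, (κ y).1 ∈ ball q.1 r :=
        (continuous_subtype_val.comp hκ).continuousAt.eventually_mem (isOpen_ball.mem_nhds hc)
      refine ⟨t', ?_⟩
      filter_upwards [hq, hκq, hκ.continuousAt.eventually ht] with y hy hκy ht
      refine ⟨?_, fun hyC ↦ ?_⟩
      · rw [continuousAt_section_iff_coordRep e (hbase y hy),
          (openBox J).isOpenEmbedding'.continuousAt_iff.symm]
        have h1 : ContinuousAt (coordRep e t) (κ y).1 :=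
          (continuousAt_section_iff_coordRep e (hbase _ hκy)).1 ht.1
        have h2 : ContinuousAt (fun z : openBox J ↦ fr.h (κ z).1 (coordRep e t (κ z).1)) y :=
          ContinuousAt.comp (f := fun z : openBox J ↦ (κ z).1)
            (((fr.continuousOn_h.continuousAt (isOpen_ball.mem_nhds hκy))).clm_apply h1)
            (continuous_subtype_val.comp hκ).continuousAt
        have h3 : ContinuousAt (fun z : openBox J ↦ fr.g z.1) y :=
          ContinuousAt.comp (f := fun z : openBox J ↦ z.1)
            (fr.continuousOn_g.continuousAt (isOpen_ball.mem_nhds hy))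
            continuous_subtype_val.continuousAt
        refine (h3.clm_apply h2).congr_of_eventuallyEq ?_
        filter_upwards [e.open_baseSet.mem_nhds (hbase y hy)] with z hz
        simp only [Function.comp]
        rw [coordRep_coe, ht'e z hz]
      · apply (e.continuousLinearEquivAt ℝ y (hbase y hy)).injective
        refine (ht'e y (hbase y hy)).trans ?_
        have hts : coordRep e t (κ y).1 = coordRep e s (κ y).1 := by
          rw [coordRep_coe, coordRep_coe, ht.2 (by
            simp only [κ]; rwa [setCoord_apply_of_ne hij])]
        have hyκ : y.1 = (κ y).1 + (y.1 i - c) • stdVec i := by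
          simp only [κ, setCoord]; module
        -- The `j`-th coordinate is constant along the segment and lies outside `C`, so the segment
        -- avoids `A` and `s` itself is parallel on it.
        have hder : ∀ τ ∈ uIcc 0 (y.1 i - c), HasFDerivAt (coordRep e s)
            (-(Γ ((κ y).1 + τ • stdVec i)).flip (coordRep e s ((κ y).1 + τ • stdVec i)))
            ((κ y).1 + τ • stdVec i) := by
          intro τ hτ
          obtain ⟨z, hz, hzτ⟩ := hball (add_smul_mem_ball hκy (hyκ ▸ hy) hτ)
          rw [← hzτ]
          refine (hΓ.isParallelOn_iff hl (U := A.compl ⊓ ⟨e.baseSet, e.open_baseSet⟩)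
            (fun _ h ↦ h.2)).1 (hs.mono inf_le_left) z ⟨fun hzA ↦ hyC ?_, hz⟩
          have h1 := (hA z hzA).2
          rw [hzτ] at h1
          simpa [hij, κ, setCoord_apply_of_ne hij] using h1
        have htr := fr.transport (t := coordRep e s) hκy (hyκ ▸ hy)
          (fun τ hτ ↦ (ContinuousAt.comp (f := fun τ : ℝ ↦ (κ y).1 + τ • stdVec i)
            (hder τ hτ).continuousAt (by fun_prop)).continuousWithinAt) countable_empty
          (fun τ hτ _ ↦ by simpa using (hder τ hτ).hasLineDerivAt (stdVec i))
        rw [hts, ← htr, ← hyκ, fr.g_h_apply hy]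
        exact coordRep_coe e s y
  choose T hT using hlocal
  have hfreq := frequently_apply_notMem (J := J) hC
  -- Two local extensions both equal `s` off `C`, hence agree; the diagonal `T x x` is therefore
  -- locally one of them.
  have hTeq : ∀ x, ∀ᶠ y in 𝓝 x, T y y = T x y := fun x ↦ by
    filter_upwards [(hT x).eventually_nhds] with y hy
    refine section_eq_of_frequently_eq (hT y).self_of_nhds.1 hy.self_of_nhds.1 ?_
    refine ((hfreq y).and_eventually ((hT y).and hy)).mono ?_
    rintro z ⟨hzC, h1, h2⟩
    rw [h1.2 hzC, h2.2 hzC]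
  have hcont : Continuous fun x ↦ TotalSpace.mk' F x (T x x) := by
    refine continuous_iff_continuousAt.2 fun x ↦ ?_
    exact (hT x).self_of_nhds.1.congr_of_eventuallyEq ((hTeq x).mono fun y hy ↦
      congrArg (TotalSpace.mk' F y) hy)
  refine ⟨fun x ↦ T x x, hcont, fun x hx ↦ ?_⟩
  refine section_eq_of_frequently_eq (s := fun x ↦ T x x) hcont.continuousAt (hsc x hx) ?_
  exact (hfreq x).mono fun y hy ↦ (hT y).self_of_nhds.2 hy

/-- A continuous section that is parallel off `A` is parallel in every direction along which `A`
projects to a set with dense complement. -/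
theorem IsConnectionForm.lineParallelAt_of_ne [FiniteDimensional ℝ F] {l m : ℕ∞} (hl : 1 ≤ l)
    [ContMDiffVectorBundle l F V (𝓡 n)] {D : Connection n F V} {e : Trivialization F (π F V)}
    [MemTrivializationAtlas e]
    {Γ : EuclideanSpace ℝ (Fin n) → EuclideanSpace ℝ (Fin n) →L[ℝ] F →L[ℝ] F}
    (hΓ : D.IsConnectionForm e m Γ) {A : Closeds (openBox J)} {j : Fin n}
    {C : Set ℝ} (hC : ∀ c ∈ J j, c ∈ closure Cᶜ) (hA : ∀ x ∈ A, x.1 j ∈ C) {t : Π x, V x}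
    (htc : Continuous (fun x ↦ TotalSpace.mk' F x (t x))) (ht : D.IsParallelOn A.compl t)
    {k : Fin n} (hk : k ≠ j) {x : openBox J} (hx : x ∈ e.baseSet) :
    LineParallelAt k (fun y ↦ Γ y (stdVec k)) (coordRep e t) x := by
  have hΩ : IsOpen (Subtype.val '' e.baseSet) :=
    (openBox J).isOpenEmbedding'.isOpenMap _ e.open_baseSet
  refine lineParallelAt_of_dense hΩ
    (hΓ.contDiffOn.continuousOn.clm_apply continuousOn_const) ?_
    (D := {y : EuclideanSpace ℝ (Fin n) | y j ∉ C}) ?_ ?_ ?_ ⟨x, hx, rfl⟩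
  · rintro _ ⟨y, hy, rfl⟩
    exact ((continuousAt_section_iff_coordRep e hy).1 htc.continuousAt).continuousWithinAt
  · rintro _ ⟨y, hy, rfl⟩
    exact mem_closure_setOf_apply_notMem hC y.2
  · intro y hy τ
    simpa [hk.symm] using hy
  · rintro _ hyC ⟨y, hy, rfl⟩
    have := (hΓ.isParallelOn_iff hl (U := A.compl ⊓ ⟨e.baseSet, e.open_baseSet⟩)
      (fun _ h ↦ h.2)).1 (ht.mono inf_le_left) y ⟨fun hyA ↦ hyC (hA y hyA), hy⟩
    simpa using this.hasLineDerivAt (stdVec k)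

end Connection

end Extension

/-! ### The three negligibility criteria -/

section Negligible

open Set Filter Topology Metric

variable {n : ℕ} {J : Fin n → Opens ℝ} {F : Type*} [NormedAddCommGroup F] [NormedSpace ℝ F]
  {V : openBox J → Type*} [TopologicalSpace (TotalSpace F V)]
  [∀ x, AddCommGroup (V x)] [∀ x, Module ℝ (V x)] [∀ x, TopologicalSpace (V x)]
  [∀ x, IsTopologicalAddGroup (V x)] [∀ x, ContinuousSMul ℝ (V x)]
  [FiberBundle F V] [VectorBundle ℝ F V]

namespace Connection

theorem isParallelOn_top_of_lineParallelAt [FiniteDimensional ℝ F] {l m : ℕ∞} (hl : 1 ≤ l)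
    [ContMDiffVectorBundle l F V (𝓡 n)] {D : Connection n F V} (hD : D.IsOfClass l m)
    {t : Π x, V x} (htc : Continuous (fun x ↦ TotalSpace.mk' F x (t x)))
    (h : ∀ (x : openBox J) Γ, D.IsConnectionForm (trivializationAt F V x) m Γ →
      ∀ y ∈ (trivializationAt F V x).baseSet, ∀ k, LineParallelAt k (fun y ↦ Γ y (stdVec k))
        (coordRep (trivializationAt F V x) t) y) :
    D.IsParallelOn ⊤ t := by
  refine isParallelOn_of_forall_exists fun x _ ↦ ?_
  obtain ⟨Γ, hΓ⟩ := D.exists_connectionForm hl hD (trivializationAt F V x)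
  exact ⟨⟨_, (trivializationAt F V x).open_baseSet⟩,
    FiberBundle.mem_baseSet_trivializationAt' x,
    hΓ.isParallelOn_of_lineParallelAt hl subset_rfl htc (h x Γ hΓ)⟩

/-- Connections of class `C⁰`: one coordinate of `A` takes countably many values. -/
theorem isNegligible_of_countable [FiniteDimensional ℝ F] {l m : ℕ∞} (hl : 1 ≤ l)
    [ContMDiffVectorBundle l F V (𝓡 n)] {D : Connection n F V} (hD : D.IsOfClass l m)
    {A : Closeds (openBox J)} {i j : Fin n} (hij : j ≠ i) (hJ : (J i : Set ℝ).OrdConnected)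
    {C : Set ℝ} (hC : C.Countable) {b : ℝ} (hb : b ∈ J i)
    (hA : ∀ x ∈ A, b ≤ x.1 i ∧ x.1 j ∈ C) : D.IsNegligible A := by
  intro s hs
  have hCd : ∀ c ∈ J j, c ∈ closure Cᶜ := fun c _ ↦ (hC.dense_compl ℝ) c
  obtain ⟨t, htc, hts⟩ := exists_continuous_extension hl hD hij hJ hCd hb hA hs
  have ht : D.IsParallelOn A.compl t := hs.congr hts
  refine ⟨t, isParallelOn_top_of_lineParallelAt hl hD htc fun x Γ hΓ y hy k ↦ ?_, hts⟩
  set e := trivializationAt F V x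
  by_cases hk : k = j
  · subst hk
    -- `N` is the set of parameters at which the line in direction `j` has its `j`-th coordinate in
    -- `C`.
    refine lineParallelAt_of_countable ((openBox J).isOpenEmbedding'.isOpenMap _ e.open_baseSet)
      (hΓ.contDiffOn.continuousOn.clm_apply continuousOn_const) ?_ ⟨y, hy, rfl⟩
      (N := (fun τ ↦ y.1 k + τ) ⁻¹' C) (hC.preimage (add_right_injective _)) ?_
    · rintro _ ⟨z, hz, rfl⟩
      exact ((continuousAt_section_iff_coordRep e hz).1 htc.continuousAt).continuousWithinAt
    · rintro τ hτ ⟨z, hz, hzτ⟩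
      rw [← hzτ]
      have := (hΓ.isParallelOn_iff hl (U := A.compl ⊓ ⟨e.baseSet, e.open_baseSet⟩)
        (fun _ h ↦ h.2)).1 (ht.mono inf_le_left) z ⟨fun hzA ↦ hτ ?_, hz⟩
      · simpa using this.hasLineDerivAt (stdVec k)
      · have h1 := (hA z hzA).2
        rw [hzτ] at h1
        simpa using h1
  · exact hΓ.lineParallelAt_of_ne hl hCd (fun x hx ↦ (hA x hx).2) htc ht hk hy

/-- Connections of class `C⁰`: two coordinates of `A` take values in sets with dense complement. -/
theorem isNegligible_of_inter [FiniteDimensional ℝ F] {l m : ℕ∞} (hl : 1 ≤ l)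
    [ContMDiffVectorBundle l F V (𝓡 n)] {D : Connection n F V} (hD : D.IsOfClass l m)
    {A : Closeds (openBox J)} {i j : Fin n} (hij : j ≠ i) (hJ : (J i : Set ℝ).OrdConnected)
    {C₁ C₂ : Set ℝ} (hC₁ : ∀ c ∈ J i, c ∈ closure C₁ᶜ) (hC₂ : ∀ c ∈ J j, c ∈ closure C₂ᶜ)
    {b : ℝ} (hb : b ∈ J i)
    (hA : ∀ x ∈ A, b ≤ x.1 i ∧ x.1 j ∈ C₂ ∧ x.1 i ∈ C₁) :
    D.IsNegligible A := by
  intro s hs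
  obtain ⟨t, htc, hts⟩ := exists_continuous_extension hl hD hij hJ hC₂ hb
    (fun x hx ↦ ⟨(hA x hx).1, (hA x hx).2.1⟩) hs
  have ht : D.IsParallelOn A.compl t := hs.congr hts
  refine ⟨t, isParallelOn_top_of_lineParallelAt hl hD htc fun x Γ hΓ y hy k ↦ ?_, hts⟩
  -- Direction `j` uses the dense lines with `x i ∉ C₁`, every other direction those with `x j ∉
  -- C₂`.
  by_cases hk : k = j
  · exact hΓ.lineParallelAt_of_ne hl hC₁ (fun x hx ↦ (hA x hx).2.2) htc ht (hk ▸ hij) hy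
  · exact hΓ.lineParallelAt_of_ne hl hC₂ (fun x hx ↦ (hA x hx).2.1) htc ht hk hy

/-- Connections of class `C¹`: one coordinate of `A` takes values in a set with dense
complement. -/
theorem isNegligible_of_class_one [FiniteDimensional ℝ F] {l : ℕ∞} (hl : 1 ≤ l)
    [ContMDiffVectorBundle l F V (𝓡 n)] {D : Connection n F V} (hD : D.IsOfClass l 1)
    {A : Closeds (openBox J)} {i j : Fin n} (hij : j ≠ i) (hJ : (J i : Set ℝ).OrdConnected)
    {C : Set ℝ} (hC : ∀ c ∈ J j, c ∈ closure Cᶜ) {b : ℝ} (hb : b ∈ J i)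
    (hA : ∀ x ∈ A, b ≤ x.1 i ∧ x.1 j ∈ C) : D.IsNegligible A := by
  intro s hs
  obtain ⟨t, htc, hts⟩ := exists_continuous_extension hl hD hij hJ hC hb hA hs
  have ht : D.IsParallelOn A.compl t := hs.congr hts
  suffices h : ∀ x, ∃ U : Opens (openBox J), x ∈ U ∧ D.IsParallelOn U t from
    ⟨t, isParallelOn_of_forall_exists fun x _ ↦ h x, hts⟩
  -- The propagated property is that `t` is parallel in a neighbourhood of the point; it holds for
  -- `x i < b` because `A` is absent there.
  refine openBox_induction ?_ hJ hb ?_ ?_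
  · exact isOpen_iff_eventually.2 fun x ⟨U, hxU, hU⟩ ↦
      (U.isOpen.eventually_mem hxU).mono fun y hy ↦ ⟨U, hy, hU⟩
  · exact fun x hx ↦ ⟨A.compl, fun h ↦ absurd (hA x h).1 (not_le.2 hx), ht⟩
  · intro q
    set e := trivializationAt F V q
    have hqe : q ∈ e.baseSet := FiberBundle.mem_baseSet_trivializationAt' q
    obtain ⟨Γ, hΓ⟩ := D.exists_connectionForm hl hD e
    have hΓ1 : ContDiffOn ℝ 1 Γ (Subtype.val '' e.baseSet) := hΓ.contDiffOn
    have hΩ : IsOpen (Subtype.val '' e.baseSet) :=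
      (openBox J).isOpenEmbedding'.isOpenMap _ e.open_baseSet
    have hrep : ContinuousOn (coordRep e t) (Subtype.val '' e.baseSet) := by
      rintro _ ⟨y, hy, rfl⟩
      exact ((continuousAt_section_iff_coordRep e hy).1 htc.continuousAt).continuousWithinAt
    have hne : ∀ k ≠ j, ∀ y ∈ e.baseSet,
        LineParallelAt k (fun y ↦ Γ y (stdVec k)) (coordRep e t) y := fun k hk y hy ↦
      hΓ.lineParallelAt_of_ne hl hC (fun x hx ↦ (hA x hx).2) htc ht hk hy
    obtain ⟨r, hr, hball, ⟨fr⟩⟩ := exists_lineFrame (A := fun y ↦ Γ y (stdVec i)) i hΩ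
      (hΓ.contDiffOn.continuousOn.clm_apply continuousOn_const) ⟨q, hqe, rfl⟩
    have hbase : ∀ y : openBox J, y.1 ∈ ball q.1 r → y ∈ e.baseSet := fun y hy ↦ by
      obtain ⟨y', hy', hyy'⟩ := hball hy
      rwa [← Subtype.ext hyy']
    have hcontc : Continuous fun c ↦ setCoord i q.1 c :=
      (continuous_setCoord i).comp (by fun_prop : Continuous fun c : ℝ ↦ (q.1, c))
    have hev : ∀ᶠ c in 𝓝 (q.1 i), setCoord i q.1 c ∈ ball q.1 r :=
      hcontc.continuousAt.eventually_mem (isOpen_ball.mem_nhds (by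
        rw [setCoord_self]; exact mem_ball_self hr))
    filter_upwards [hev] with c hc h
    rintro ⟨U, hqU, hU⟩
    have hcJ : c ∈ J i := by have := h i; rwa [setCoord_apply_same] at this
    let κ : openBox J → openBox J := fun y ↦ ⟨setCoord i y.1 c, setCoord_mem_openBox y.2 hcJ⟩
    have hκ : Continuous κ := ((continuous_setCoord i).comp
      (by fun_prop : Continuous fun y : openBox J ↦ (y.1, c))).subtype_mk _
    -- The neighbourhood of `q` whose points are joined, inside the ball carrying the frame, to
    -- points of `U` by segments in direction `i`.
    let W : Opens (openBox J) := ⟨{y | y.1 ∈ ball q.1 r ∧ (κ y).1 ∈ ball q.1 r ∧ κ y ∈ U},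
      (isOpen_ball.preimage continuous_subtype_val).inter
        ((isOpen_ball.preimage (continuous_subtype_val.comp hκ)).inter (U.isOpen.preimage hκ))⟩
    have hWe : (W : Set (openBox J)) ⊆ e.baseSet := fun y hy ↦ hbase y hy.1
    refine ⟨W, ⟨mem_ball_self hr, hc, hqU⟩, hΓ.isParallelOn_of_lineParallelAt hl hWe htc ?_⟩
    rintro y ⟨hy, hκy, hκU⟩ k
    by_cases hk : k = j
    · subst hk
      have hyκ : y.1 = (κ y).1 + (y.1 i - c) • stdVec i := by
        simp only [κ, setCoord]; module
      have hstart : LineParallelAt k (fun y ↦ Γ y (stdVec k)) (coordRep e t) (κ y).1 := by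
        have := (hΓ.isParallelOn_iff hl (U := U ⊓ ⟨e.baseSet, e.open_baseSet⟩)
          (fun _ h ↦ h.2)).1 (hU.mono inf_le_left) (κ y) ⟨hκU, hbase _ hκy⟩
        simpa using this.hasLineDerivAt (stdVec k)
      rw [hyκ]
      refine fr.lineParallelAt_propagate k hΩ hΓ1 hrep
        (O := Subtype.val '' (A.compl : Set (openBox J)))
        ((openBox J).isOpenEmbedding'.isOpenMap _ A.compl.isOpen) ?_ ?_ ?_ hball hκy
        (hyκ ▸ hy) hstart
      · rintro _ ⟨z, -, rfl⟩
        rw [mem_closure_iff_frequently, ← (openBox J).isOpenEmbedding'.map_nhds_eq,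
          frequently_map]
        exact (frequently_apply_notMem hC z).mono fun w hw ↦ ⟨w, fun hwA ↦ hw (hA w hwA).2, rfl⟩
      · rintro _ ⟨z, hz, rfl⟩ ⟨z', hz', hzz'⟩
        refine (hΓ.isParallelOn_iff hl (U := A.compl ⊓ ⟨e.baseSet, e.open_baseSet⟩)
          (fun _ h ↦ h.2)).1 (ht.mono inf_le_left) z ⟨hz, ?_⟩
        rwa [← Subtype.ext hzz']
      · rintro _ ⟨z, hz, rfl⟩
        exact hne i hij.symm z hz
    · exact hne k hk y (hbase y hy)

end Connection

/-- The only consequence of nowhere density that the criteria need; as it is relative to `U`, it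
says nothing outside `U`. -/
theorem mem_closure_compl_of_isNowhereDense {U : Opens ℝ} {C : Set ℝ}
    (hC : IsNowhereDense ((↑) ⁻¹' C : Set U)) (c : ℝ) (hc : c ∈ U) : c ∈ closure Cᶜ := by
  have h1 : Dense (((↑) ⁻¹' C : Set U)ᶜ) := by
    rw [← interior_eq_empty_iff_dense_compl, Set.eq_empty_iff_forall_notMem]
    intro x hx
    have h2 : interior (closure ((↑) ⁻¹' C : Set U)) = ∅ := hC
    exact (h2 ▸ interior_mono subset_closure hx : x ∈ (∅ : Set U))
  exact map_mem_closure continuous_subtype_val (h1 ⟨c, hc⟩) fun x hx ↦ hx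

end Negligible

theorem mainTheorem6 (k : ℕ∞) (hk : 1 ≤ k) (n : ℕ) (hn : 2 ≤ n)
    (J : Fin n → Opens ℝ) (hJ : ∀ i, (J i : Set ℝ).OrdConnected)
    (i₁ i₂ : Fin n) (hi₁ : (i₁ : ℕ) = 0) (hi₂ : (i₂ : ℕ) = 1)
    (F : Closeds (openBox J)) :
    (∀ (C₂ : Set ℝ) (b₁ : ℝ), C₂ ⊆ J i₂ → DiscreteTopology C₂ → b₁ ∈ J i₁ →
      (∀ x ∈ F, b₁ ≤ x.1 i₁ ∧ x.1 i₂ ∈ C₂) →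
      NegligibleForAllConnections.{0, uF, uV} n k 0 F) ∧
    (∀ (C₂ : Set ℝ) (b₁ : ℝ), C₂ ⊆ J i₂ →
      IsNowhereDense ((↑) ⁻¹' C₂ : Set (J i₂)) → b₁ ∈ J i₁ →
      (∀ x ∈ F, b₁ ≤ x.1 i₁ ∧ x.1 i₂ ∈ C₂) →
      NegligibleForAllConnections.{0, uF, uV} n k 1 F) ∧
    (∀ (C₁ C₂ : Set ℝ) (b₁ b₂ : ℝ), C₁ ⊆ J i₁ → C₂ ⊆ J i₂ →
      IsNowhereDense ((↑) ⁻¹' C₁ : Set (J i₁)) → IsNowhereDense ((↑) ⁻¹' C₂ : Set (J i₂)) →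
      b₁ ∈ J i₁ → b₂ ∈ J i₂ →
      (∀ x ∈ F, (b₁ ≤ x.1 i₁ ∧ x.1 i₂ ∈ C₂) ∧ (b₂ ≤ x.1 i₂ ∧ x.1 i₁ ∈ C₁)) →
      NegligibleForAllConnections.{0, uF, uV} n k 0 F) := by
  have hij : i₂ ≠ i₁ := fun h ↦ by
    rw [h, hi₁] at hi₂
    exact zero_ne_one hi₂
  refine ⟨?_, ?_, ?_⟩
  · intro C₂ b₁ _ hC₂ hb₁ hF l hl _ E _ _ _ V _ _ _ _ _ _ _ _ _ D hD
    -- A discrete subspace of `ℝ` is separable, hence countable.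
    exact Connection.isNegligible_of_countable hl hD hij (hJ i₁)
      (Set.countable_coe_iff.1 (TopologicalSpace.separableSpace_iff_countable.1 inferInstance))
      hb₁ hF
  · intro C₂ b₁ _ hC₂ hb₁ hF l hl _ E _ _ _ V _ _ _ _ _ _ _ _ _ D hD
    exact Connection.isNegligible_of_class_one hl hD hij (hJ i₁)
      (mem_closure_compl_of_isNowhereDense hC₂) hb₁ hF
  · intro C₁ C₂ b₁ b₂ _ _ hC₁ hC₂ hb₁ _ hF l hl _ E _ _ _ V _ _ _ _ _ _ _ _ _ D hD
    exact Connection.isNegligible_of_inter hl hD hij (hJ i₁)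
      (mem_closure_compl_of_isNowhereDense hC₁) (mem_closure_compl_of_isNowhereDense hC₂) hb₁
      fun x hx ↦ ⟨(hF x hx).1.1, (hF x hx).1.2, (hF x hx).2.2⟩
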